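/- Let $d\ge 1$, let $(n_k)_{k\ge1}$ be integers with $n_k\ge 2$, let $\Sigma^k=\{u_1\cdots u_k: 1\le u_j\le n_j\}$, $\Sigma^*=\bigcup_{k\ge0}\Sigma^k$, and let $\Sigma^\infty$ be the set of infinite words $u_1u_2\cdots$ with $1\le u_j\le n_j$. For $k\ge1$ and $1\le j\le n_k$ let $T_{k,j}:\mathbb R^d\to\mathbb R^d$ be nonsingular linear maps with $\|T_{k,j}\|<1$. Write $\alpha_1(T)\ge\dots\ge\alpha_d(T)$ for the singular values of a linear map $T$, and assume $$0<\alpha_-:=\inf_{k,j}\alpha_d(T_{k,j})\quad\text{and}\quad \alpha_+:=\sup_{k,j}\alpha_1(T_{k,j})<1 .$$ For $u=u_1\cdots u_k\in\Sigma^*$ put $T_u=T_{1,u_1}\cdots T_{k,u_k}$. The singular value function is $\phi^0(T)=1$, $\phi^s(T)=\alpha_1(T)\cdots\alpha_{m-1}(T)\,\alpha_m(T)^{s-m+1}$ for $0<s\le d$, where $m$ is the integer with $m-1<s\le m$, and $\phi^s(T)=(\alpha_1(T)\cdots\alpha_d(T))^{s/d}$ for $s>d$. For $s\ge0$ let $$\mathcal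 M^s(\Sigma^\infty)=\lim_{k\to\infty}\ \inf\Big\{\sum_{u\in A}\phi^s(T_u)\ :\ A\subset\Sigma^*,\ |u|\ge k\text{ for all }u\in A,\ \Sigma^\infty=\bigcup_{u\in A}\mathcal C_u\Big\},$$ where $\mathcal C_u\subset\Sigma^\infty$ is the set of infinite words that begin with $u$, and let $$s_A=\inf\{s\ge0:\mathcal M^s(\Sigma^\infty)=0\}\in[0,\infty].$$ Let $J\subset\mathbb R^d$ be a compact set with nonempty interior. For $\omega=(\omega_u)_{u\in\Sigma^*}\in(\mathbb R^d)^{\Sigma^*}$ and $u=u_1\cdots u_k\in\Sigma^k$ let $J_u=\Psi_{u_1}\circ\cdots\circ\Psi_{u_k}(J)$, where $\Psi_{u_j}(x)=T_{j,u_j}x+\omega_{u_1\cdots u_j}$, with $J_\emptyset=J$. The collection $(J_u)_{u\in\Sigma^*}$ fulfils the self-affine Moran structure if the $J_u$ are closed subsets of $J$, $J_{uj}\subset J_u$ for all $k\ge1$, $u\in\Sigma^{k-1}$ and $1\le j\le n_k$, and $\lim_{k\to\infty}\max_{u\in\Sigma^k}\operatorname{diam}J_u=0$. Let $$E^\omega=\bigcap_{k\ge1}\bigcup_{u\in\Sigma^k}J_u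 .$$ Let the $\omega_u$, $u\in\Sigma^*$, be independent random vectors with the same law $P$, a Borel probability measure that is carried by a bounded set $\mathcal D\subset\mathbb R^d$ and is absolutely continuous with respect to Lebesgue measure $\mathcal L^d$; let $\mathbf P=\prod_{u\in\Sigma^*}P$ be the law of $\omega$. Assume that for $\mathbf P$-almost every $\omega$ the collection $(J_u)$ fulfils the self-affine Moran structure. Then for $\mathbf P$-almost every $\omega$: (1) $\dim_{\rm H}E^\omega=s_A$ if $s_A\le d$; (2) $\mathcal L^d(E^\omega)>0$ if $s_A>d$. -/

import Mathlib

open MeasureTheory Filter Topology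
open scoped ENNReal NNReal

noncomputable section

namespace MoranSet

/-- `d`-dimensional Euclidean space. -/
abbrev Space (d : ℕ) : Type := EuclideanSpace ℝ (Fin d)

/-- Words of length `k`. Levels are counted from `0`, so that the letter in position `i` ranges
over an alphabet of size `n i`, for `i = 0, …, k - 1`. -/
abbrev Word (n : ℕ → ℕ) (k : ℕ) : Type := (i : Fin k) → Fin (n i)

/-- All finite words, the empty word included. -/
abbrev FinWord (n : ℕ → ℕ) : Type := Σ k : ℕ, Word n k

/-- Infinite words. -/
abbrev InfWord (n : ℕ → ℕ) : Type := (i : ℕ) → Fin (n i)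

/-- The word with its last letter removed. -/
def Word.init {n : ℕ → ℕ} {k : ℕ} (u : Word n (k + 1)) : Word n k := fun i => u i.castSucc

/-- The last letter of a word. -/
def Word.last {n : ℕ → ℕ} {k : ℕ} (u : Word n (k + 1)) : Fin (n k) := u (Fin.last k)

/-- The cylinder of all infinite words that begin with `u`. -/
def cylinder {n : ℕ → ℕ} (u : FinWord n) : Set (InfWord n) :=
  {v | ∀ i : Fin u.1, v i = u.2 i}

/-- A family of linear maps: `n k` maps at each level `k`. -/
abbrev LinFamily (d : ℕ) (n : ℕ → ℕ) : Type := (k : ℕ) → Fin (n k) → (Space d →L[ℝ] Space d)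

/-- The composition `T_u = T_{0,u₀} ∘ T_{1,u₁} ∘ ⋯ ∘ T_{k-1,u_{k-1}}`. -/
def linComp {d : ℕ} {n : ℕ → ℕ} (T : LinFamily d n) :
    (k : ℕ) → Word n k → (Space d →L[ℝ] Space d)
  | 0, _ => ContinuousLinearMap.id ℝ (Space d)
  | k + 1, u => (linComp T k u.init).comp (T k u.last)

/-- The affine map `Ψ_u`: the composition over `j = 1, …, k` of the maps
`x ↦ T_{j-1,u_{j-1}} x + ω_{u₀⋯u_{j-1}}`, the one for `j = k` being applied first. -/
def affComp {d : ℕ} {n : ℕ → ℕ} (T : LinFamily d n) (ω : FinWord n → Space d) :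
    (k : ℕ) → Word n k → Space d → Space d
  | 0, _ => id
  | k + 1, u => fun x => affComp T ω k u.init (T k u.last x + ω ⟨k + 1, u⟩)

/-- The basic set `J_u = Ψ_u(J)`. -/
def basicSet {d : ℕ} {n : ℕ → ℕ} (T : LinFamily d n) (J : Set (Space d))
    (ω : FinWord n → Space d) (k : ℕ) (u : Word n k) : Set (Space d) :=
  affComp T ω k u '' J

/-- The collection of the sets `J_u = Ψ_u(J)` fulfils the self-affine Moran structure. -/
structure IsMoranStructure {d : ℕ} {n : ℕ → ℕ} (T : LinFamily d n) (J : Set (Space d))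
    (ω : FinWord n → Space d) : Prop where
  isClosed : ∀ (k : ℕ) (u : Word n k), IsClosed (basicSet T J ω k u)
  subset_base : ∀ (k : ℕ) (u : Word n k), basicSet T J ω k u ⊆ J
  nested : ∀ (k : ℕ) (u : Word n (k + 1)), basicSet T J ω (k + 1) u ⊆ basicSet T J ω k u.init
  diam_tendsto :
    Tendsto (fun k => ⨆ u : Word n k, Metric.diam (basicSet T J ω k u)) atTop (𝓝 0)

/-- The self-affine Moran set `E = ⋂_{k ≥ 1} ⋃_{|u| = k} J_u`. -/
def moranSet {d : ℕ} {n : ℕ → ℕ} (T : LinFamily d n) (J : Set (Space d))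
    (ω : FinWord n → Space d) : Set (Space d) :=
  ⋂ (k : ℕ) (_ : 1 ≤ k), ⋃ u : Word n k, basicSet T J ω k u

/-- The `i`-th singular value of `A`, in decreasing order and counted from `0`: the value of index
`i` is `α_{i+1}(A)`. -/
def singVal {d : ℕ} (A : Space d →L[ℝ] Space d) (i : ℕ) : ℝ :=
  (A : Space d →ₗ[ℝ] Space d).singularValues i

/-- The singular value function `φ^s(A) = α_1 ⋯ α_{m-1} α_m^{s-m+1}`, `m = ⌈s⌉`, for `0 < s ≤ d`,
with `φ^0(A) = 1` and `φ^s(A) = (α_1 ⋯ α_d)^{s/d}` for `s > d`. In the code `⌈s⌉₊ - 1` is `m - 1`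
for `s > 0`, and it is `0` for `s = 0`. -/
def svf {d : ℕ} (s : ℝ≥0) (A : Space d →L[ℝ] Space d) : ℝ :=
  if s ≤ d then
    (∏ i ∈ Finset.range (⌈s⌉₊ - 1), singVal A i) *
      singVal A (⌈s⌉₊ - 1) ^ ((s : ℝ) - ((⌈s⌉₊ - 1 : ℕ) : ℝ))
  else
    (∏ i ∈ Finset.range d, singVal A i) ^ ((s : ℝ) / (d : ℝ))

/-- `α_+`, the supremum of the largest singular values of all the maps of the family. -/
def alphaPlus {d : ℕ} {n : ℕ → ℕ} (T : LinFamily d n) : ℝ :=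
  ⨆ p : Σ k : ℕ, Fin (n k), singVal (T p.1 p.2) 0

/-- `α_-`, the infimum of the smallest singular values of all the maps of the family. -/
def alphaMinus {d : ℕ} {n : ℕ → ℕ} (T : LinFamily d n) : ℝ :=
  ⨅ p : Σ k : ℕ, Fin (n k), singVal (T p.1 p.2) (d - 1)

/-- `M^s_(k)(G)`: the infimum of `∑ φ^s(T_u)` over the families of words of length at least `k`
whose cylinders cover `G`. -/
def netPremeasure {d : ℕ} {n : ℕ → ℕ} (T : LinFamily d n) (s : ℝ≥0) (k : ℕ)
    (G : Set (InfWord n)) : ℝ≥0∞ :=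
  ⨅ (A : Set (FinWord n)) (_ : ∀ u ∈ A, k ≤ u.1) (_ : G ⊆ ⋃ u ∈ A, cylinder u),
    ∑' u : A, ENNReal.ofReal (svf s (linComp T u.1.1 u.1.2))

/-- The net measure `M^s(G) = lim_k M^s_(k)(G)`; the limit is a supremum, as `M^s_(k)(G)` is
nondecreasing in `k`. -/
def netMeasure {d : ℕ} {n : ℕ → ℕ} (T : LinFamily d n) (s : ℝ≥0) (G : Set (InfWord n)) : ℝ≥0∞ :=
  ⨆ k : ℕ, netPremeasure T s k G

/-- The critical value `s_A = inf {s ≥ 0 : M^s(Σ^∞) = 0}`, which is `∞` if there is no such `s`. -/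
def criticalValue {d : ℕ} {n : ℕ → ℕ} (T : LinFamily d n) : ℝ≥0∞ :=
  ⨅ (s : ℝ≥0) (_ : netMeasure T s Set.univ = 0), (s : ℝ≥0∞)

end MoranSet

end

/-! Upper bound. Every point of the Moran set has an address, so a cover of `Σ^∞` by cylinders `C_u`
yields a cover of `E` by the sets `J_u`. With `m = ⌈s⌉`, each `J_u` splits into about `∏_{i<m}
α_i/α_m` pieces of diameter comparable to `α_m(T_u)`, and the sum of the `s`-th powers of their
diameters is at most a constant times `φ^s(T_u)`. If `M^s(Σ^∞) = 0` with `s ≤ d`, the Hausdorff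
measure of exponent `s` of `E` is finite (`IsMoranStructure.dimH_le`).

Lower bound. For `t' < s_A`, a random descent in the tree of words, with weights given by the net
premeasure, produces a probability measure `μ` on `Σ^∞` with `μ(C_u) ≤ C φ^{t'}(T_u)` for long `u`
(`exists_frostman_measure`). The main point is transversality (`exists_measure_closeEvent_le`): if
`v` and `v'` differ in position `k`, their points `π(v)`, `π(v')` are within `r` with probability at
most `C r^t / φ^t(T_{v|k})`, for `t ≤ d`. The translation at a prefix of `v` longer than `k` moves
`π(v)` and not `π(v')`; with all others frozen, proximity confines it to a set of small volume.

The density of `P` may be unbounded. The translation to resample is therefore the first one along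
`v`, past position `k`, that falls in a set `G` of bounded density. If this happens after `l`
misses, the volume bound worsens by `α^{-ld}`, where `α` bounds the singular values from below; but
`l` misses have probability `P(Gᶜ)^l ≤ (α^d/2)^l`, so the sum over `l` converges.

Integrating over `μ × μ`, the expected mass of the pairs at distance at most `r` is `O(r^t)` for `t
< t'`, `t ≤ d` (`exists_lintegral_closePairs_le`). For `s < t`, summing over dyadic `r` gives almost
surely a finite energy and, by the mass distribution principle, a positive Hausdorff measure. If
`s_A > d`, the choice `t = d` and Fatou's lemma give finite lower densities with respect to volume,
hence positive volume. -/

noncomputable section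

namespace MoranSet

/-! ### Singular values, volume and covering estimates -/

section LinearAlgebra

variable {d : ℕ}

theorem singVal_nonneg (A : Space d →L[ℝ] Space d) (i : ℕ) : 0 ≤ singVal A i :=
  LinearMap.singularValues_nonneg _ _

theorem singVal_antitone (A : Space d →L[ℝ] Space d) : Antitone (singVal A) :=
  LinearMap.singularValues_antitone _

/-- Right singular vectors. -/
theorem exists_orthonormalBasis_norm_sq (A : Space d →L[ℝ] Space d) :
    ∃ b : OrthonormalBasis (Fin d) ℝ (Space d),
      ∀ x, ‖A x‖ ^ 2 = ∑ i : Fin d, (singVal A i * b.repr x i) ^ 2 := by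
  set L : Space d →ₗ[ℝ] Space d := (A : Space d →ₗ[ℝ] Space d) with hL
  have hfin : Module.finrank ℝ (Space d) = d := by simp
  have hS := L.isSymmetric_adjoint_comp_self
  refine ⟨hS.eigenvectorBasis hfin, fun x => ?_⟩
  set b := hS.eigenvectorBasis hfin with hb
  have h1 : ‖A x‖ ^ 2 = inner ℝ x ((LinearMap.adjoint L ∘ₗ L) x) := by
    rw [LinearMap.comp_apply, LinearMap.adjoint_inner_right, ← real_inner_self_eq_norm_sq]
    rfl
  rw [h1, ← b.repr.inner_map_map, PiLp.inner_apply]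
  refine Finset.sum_congr rfl fun i _ => ?_
  rw [hS.eigenvectorBasis_apply_self_apply hfin x i, ← L.sq_singularValues_fin hfin i]
  simp only [singVal, RCLike.inner_apply, RCLike.ofReal_real_eq_id, id_eq, conj_trivial, ← hL]
  ring

theorem norm_le_singVal_zero (A : Space d →L[ℝ] Space d) (x : Space d) :
    ‖A x‖ ≤ singVal A 0 * ‖x‖ := by
  obtain ⟨b, hb⟩ := exists_orthonormalBasis_norm_sq A
  refine le_of_sq_le_sq ?_ (mul_nonneg (singVal_nonneg _ _) (norm_nonneg _))
  rw [hb, mul_pow, ← b.repr.norm_map x, EuclideanSpace.norm_sq_eq, Finset.mul_sum]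
  refine Finset.sum_le_sum fun i _ => ?_
  rw [mul_pow, Real.norm_eq_abs, sq_abs]
  exact mul_le_mul_of_nonneg_right
    (pow_le_pow_left₀ (singVal_nonneg _ _) (singVal_antitone A (Nat.zero_le _)) 2) (sq_nonneg _)

theorem singVal_last_le_norm (A : Space d →L[ℝ] Space d) (x : Space d) :
    singVal A (d - 1) * ‖x‖ ≤ ‖A x‖ := by
  obtain ⟨b, hb⟩ := exists_orthonormalBasis_norm_sq A
  refine le_of_sq_le_sq ?_ (norm_nonneg _)
  rw [hb, mul_pow, ← b.repr.norm_map x, EuclideanSpace.norm_sq_eq, Finset.mul_sum]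
  refine Finset.sum_le_sum fun i _ => ?_
  rw [mul_pow, Real.norm_eq_abs, sq_abs]
  exact mul_le_mul_of_nonneg_right
    (pow_le_pow_left₀ (singVal_nonneg _ _) (singVal_antitone A (by omega)) 2) (sq_nonneg _)

theorem exists_norm_eq_singVal (A : Space d →L[ℝ] Space d) {i : ℕ} (hi : i < d) :
    ∃ x : Space d, ‖x‖ = 1 ∧ ‖A x‖ = singVal A i := by
  obtain ⟨b, hb⟩ := exists_orthonormalBasis_norm_sq A
  refine ⟨b ⟨i, hi⟩, b.norm_eq_one _, ?_⟩
  rw [← sq_eq_sq₀ (norm_nonneg _) (singVal_nonneg _ _), hb,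
    Finset.sum_eq_single (⟨i, hi⟩ : Fin d)]
  · simp
  · intro j _ hj
    simp [hj]
  · simp

theorem singVal_le_of_forall_norm_le {A : Space d →L[ℝ] Space d} {c : ℝ}
    (h : ∀ x, ‖A x‖ ≤ c * ‖x‖) {i : ℕ} (hi : i < d) : singVal A i ≤ c := by
  obtain ⟨x, hx, hAx⟩ := exists_norm_eq_singVal A hi
  simpa [hx, hAx] using h x

theorem le_singVal_of_forall_le_norm {A : Space d →L[ℝ] Space d} {c : ℝ}
    (h : ∀ x, c * ‖x‖ ≤ ‖A x‖) {i : ℕ} (hi : i < d) : c ≤ singVal A i := by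
  obtain ⟨x, hx, hAx⟩ := exists_norm_eq_singVal A hi
  simpa [hx, hAx] using h x

theorem abs_det_eq_prod_singVal (A : Space d →L[ℝ] Space d) :
    |LinearMap.det (A : Space d →ₗ[ℝ] Space d)| = ∏ i ∈ Finset.range d, singVal A i := by
  rw [← LinearMap.normDet_eq_abs_det, LinearMap.normDet_eq_prod_singularValues]
  simp [singVal]

/-- The exponent of the `i`-th singular value in the singular value function `φ^s`, `s ≤ d`. -/
def svExp (s : ℝ) (i : ℕ) : ℝ := min 1 (max 0 (s - i))

theorem svExp_nonneg (s : ℝ) (i : ℕ) : 0 ≤ svExp s i := by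
  simp [svExp]

theorem svExp_le_one (s : ℝ) (i : ℕ) : svExp s i ≤ 1 := by
  simp [svExp]

theorem svExp_mono {s t : ℝ} (h : s ≤ t) (i : ℕ) : svExp s i ≤ svExp t i := by
  unfold svExp
  gcongr

theorem svExp_of_lt {s : ℝ≥0} {i : ℕ} (h : i < ⌈s⌉₊ - 1) : svExp s i = 1 := by
  have h1 : i + 1 < ⌈s⌉₊ := by omega
  have h2 : ((i + 1 : ℕ) : ℝ≥0) < s := Nat.lt_ceil.1 h1
  have h3 : ((i : ℝ) + 1) < s := by exact_mod_cast h2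
  rw [svExp, min_eq_left]
  exact le_max_of_le_right (by linarith)

theorem svExp_ceil (s : ℝ≥0) :
    svExp s (⌈s⌉₊ - 1) = (s : ℝ) - ((⌈s⌉₊ - 1 : ℕ) : ℝ) := by
  have h1 : (s : ℝ) ≤ ⌈s⌉₊ := by exact_mod_cast Nat.le_ceil s
  have h2 : ((⌈s⌉₊ - 1 : ℕ) : ℝ) ≤ s := by
    rcases Nat.eq_zero_or_pos ⌈s⌉₊ with h | h
    · simp [h]
    · have : ⌈s⌉₊ - 1 < ⌈s⌉₊ := by omega
      have := Nat.lt_ceil.1 this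
      exact_mod_cast this.le
  have h3 : (s : ℝ) ≤ ((⌈s⌉₊ - 1 : ℕ) : ℝ) + 1 := by
    refine h1.trans ?_
    exact_mod_cast (by omega : ⌈s⌉₊ ≤ ⌈s⌉₊ - 1 + 1)
  rw [svExp, max_eq_right (by linarith), min_eq_right (by linarith)]

theorem svExp_of_gt {s : ℝ≥0} {i : ℕ} (h : ⌈s⌉₊ - 1 < i) : svExp s i = 0 := by
  have h1 : ⌈s⌉₊ ≤ i := by omega
  have h2 : (s : ℝ) ≤ i := by exact_mod_cast Nat.ceil_le.1 h1
  rw [svExp, max_eq_left (by linarith)]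
  simp

theorem ceil_sub_one_lt {s : ℝ≥0} (hd : 0 < d) (hs : s ≤ d) : ⌈s⌉₊ - 1 < d := by
  have : ⌈s⌉₊ ≤ d := Nat.ceil_le.2 hs
  omega

/-- Splitting of a product over `range d` according to the exponents `svExp s`. -/
theorem prod_range_svExp {s : ℝ≥0} (hd : 0 < d) (hs : s ≤ d) {M : Type*} [CommMonoid M]
    (f : ℕ → ℝ → M) (hf : ∀ i, f i 0 = 1) :
    ∏ i ∈ Finset.range d, f i (svExp s i) =
      (∏ i ∈ Finset.range (⌈s⌉₊ - 1), f i 1) *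
        f (⌈s⌉₊ - 1) ((s : ℝ) - ((⌈s⌉₊ - 1 : ℕ) : ℝ)) := by
  have hp := ceil_sub_one_lt hd hs
  obtain ⟨e, he⟩ : ∃ e, d = (⌈s⌉₊ - 1 + 1) + e := ⟨d - (⌈s⌉₊ - 1 + 1), by omega⟩
  rw [he, Finset.prod_range_add, Finset.prod_range_succ, svExp_ceil]
  rw [Finset.prod_eq_one (s := Finset.range e), mul_one]
  · congr 1
    exact Finset.prod_congr rfl fun i hi => by rw [svExp_of_lt (Finset.mem_range.1 hi)]
  · intro i _
    rw [svExp_of_gt (by omega), hf]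

/-- The exponents lie in `[0, 1]`, increase with `s` and sum to `s`, so in this form estimates for
`φ^s` can be made one singular value at a time. -/
theorem svf_eq_prod {s : ℝ≥0} (hd : 0 < d) (hs : s ≤ d) (A : Space d →L[ℝ] Space d) :
    svf s A = ∏ i ∈ Finset.range d, singVal A i ^ svExp s i := by
  rw [prod_range_svExp hd hs (fun i e => singVal A i ^ e) (fun i => Real.rpow_zero _), svf,
    if_pos hs]
  simp only [Real.rpow_one]

theorem sum_svExp {s : ℝ≥0} (hd : 0 < d) (hs : s ≤ d) :
    ∑ i ∈ Finset.range d, svExp s i = s := by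
  have := prod_range_svExp hd hs (fun _ e => Multiplicative.ofAdd e) (fun i => rfl)
  have h2 := congrArg Multiplicative.toAdd this
  simpa using h2

theorem svf_pos {A : Space d →L[ℝ] Space d} (hA : ∀ i < d, 0 < singVal A i) (hd : 0 < d)
    (s : ℝ≥0) : 0 < svf s A := by
  by_cases hs : s ≤ d
  · rw [svf_eq_prod hd hs]
    exact Finset.prod_pos fun i hi => Real.rpow_pos_of_pos (hA i (Finset.mem_range.1 hi)) _
  · rw [svf, if_neg hs]
    exact Real.rpow_pos_of_pos
      (Finset.prod_pos fun i hi => hA i (Finset.mem_range.1 hi)) _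

theorem svf_dim_eq_prod (hd : 0 < d) (A : Space d →L[ℝ] Space d) :
    svf (d : ℝ≥0) A = ∏ i ∈ Finset.range d, singVal A i := by
  rw [svf_eq_prod hd le_rfl]
  refine Finset.prod_congr rfl fun i hi => ?_
  have : (i : ℝ) + 1 ≤ d := by exact_mod_cast Finset.mem_range.1 hi
  rw [svExp, min_eq_left, Real.rpow_one]
  refine le_max_of_le_right ?_
  simp only [NNReal.coe_natCast]
  linarith

/-- Passing from `s` to `t` raises the exponents by nonnegative amounts of total `t - s`, and each
extra factor has base at most `c`. -/
theorem svf_le_svf_mul_of_le_dim {A : Space d →L[ℝ] Space d} (hA : ∀ i < d, 0 < singVal A i)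
    (hd : 0 < d) {s t : ℝ≥0} (hst : s ≤ t) (ht : t ≤ d) {c : ℝ}
    (hc : ∀ i < d, singVal A i ≤ c) :
    svf t A ≤ svf s A * c ^ ((t : ℝ) - s) := by
  have hc0 : 0 < c := (hA 0 hd).trans_le (hc 0 hd)
  have hst' : (s : ℝ) ≤ t := by exact_mod_cast hst
  have h1 : ((t : ℝ) - s) = ∑ i ∈ Finset.range d, (svExp t i - svExp s i) := by
    rw [Finset.sum_sub_distrib, sum_svExp hd ht, sum_svExp hd (hst.trans ht)]
  rw [svf_eq_prod hd ht, svf_eq_prod hd (hst.trans ht), h1, Real.rpow_sum_of_pos hc0,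
    ← Finset.prod_mul_distrib]
  refine Finset.prod_le_prod (fun i _ => Real.rpow_nonneg (singVal_nonneg _ _) _) fun i hi => ?_
  have hi' := Finset.mem_range.1 hi
  calc singVal A i ^ svExp t i
      = singVal A i ^ svExp s i * singVal A i ^ (svExp t i - svExp s i) := by
        rw [← Real.rpow_add (hA i hi')]; ring_nf
    _ ≤ _ := by
        refine mul_le_mul_of_nonneg_left ?_ (Real.rpow_nonneg (singVal_nonneg _ _) _)
        exact Real.rpow_le_rpow (singVal_nonneg _ _) (hc i hi')
          (sub_nonneg.2 (svExp_mono hst' i))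

/-- Beyond `d` the extra factor is `(α_1 ⋯ α_d)^{(t-d)/d}`, at most `c^{t-d}`; the two regimes are
glued at exponent `d`. -/
theorem svf_le_svf_mul {A : Space d →L[ℝ] Space d} (hA : ∀ i < d, 0 < singVal A i)
    (hd : 0 < d) {s t : ℝ≥0} (hst : s ≤ t) (hs : s ≤ d) {c : ℝ}
    (hc : ∀ i < d, singVal A i ≤ c) :
    svf t A ≤ svf s A * c ^ ((t : ℝ) - s) := by
  rcases le_or_gt t d with ht | ht
  · exact svf_le_svf_mul_of_le_dim hA hd hst ht hc
  have hc0 : 0 < c := (hA 0 hd).trans_le (hc 0 hd)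
  have hdt : (d : ℝ) < t := by exact_mod_cast ht
  have hd0 : (0 : ℝ) < d := by exact_mod_cast hd
  have h1 := svf_le_svf_mul_of_le_dim hA hd hs le_rfl hc
  have hpos : 0 < ∏ i ∈ Finset.range d, singVal A i :=
    Finset.prod_pos fun i hi => hA i (Finset.mem_range.1 hi)
  have h2 : svf t A ≤ svf (d : ℝ≥0) A * c ^ ((t : ℝ) - d) := by
    rw [svf_dim_eq_prod hd, svf, if_neg (not_le.2 ht)]
    have e1 : (t : ℝ) / d = 1 + (t - d) / d := by field_simp; ring
    rw [e1, Real.rpow_add hpos, Real.rpow_one]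
    refine mul_le_mul_of_nonneg_left ?_ hpos.le
    have h3 : ∏ i ∈ Finset.range d, singVal A i ≤ c ^ (d : ℝ) := by
      rw [Real.rpow_natCast]
      calc _ ≤ ∏ _i ∈ Finset.range d, c :=
            Finset.prod_le_prod (fun i _ => singVal_nonneg _ _)
              fun i hi => hc i (Finset.mem_range.1 hi)
        _ = _ := by simp
    calc _ ≤ (c ^ (d : ℝ)) ^ (((t : ℝ) - d) / d) :=
          Real.rpow_le_rpow hpos.le h3 (div_nonneg (by linarith) hd0.le)
      _ = _ := by rw [← Real.rpow_mul hc0.le]; congr 1; field_simp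
  calc svf t A ≤ svf (d : ℝ≥0) A * c ^ ((t : ℝ) - d) := h2
    _ ≤ (svf s A * c ^ ((d : ℝ) - s)) * c ^ ((t : ℝ) - d) := by
        refine mul_le_mul_of_nonneg_right ?_ (Real.rpow_nonneg hc0.le _)
        simpa using h1
    _ = _ := by rw [mul_assoc, ← Real.rpow_add hc0]; ring_nf

/-- The measure of a set on which both `x` and `A x` vary little. -/
theorem volume_le_div_svf {A : Space d →L[ℝ] Space d} (hA : ∀ i < d, 0 < singVal A i)
    (hd : 0 < d) {t : ℝ≥0} (ht : t ≤ d) {R r : ℝ} (hR : 1 ≤ R) (hr : 0 < r)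
    {S : Set (Space d)} (hS : ∀ x ∈ S, ∀ y ∈ S, ‖x - y‖ ≤ R ∧ ‖A (x - y)‖ ≤ r) :
    volume S ≤ ENNReal.ofReal ((2 * R) ^ d * (r ^ (t : ℝ) / svf t A)) := by
  rcases S.eq_empty_or_nonempty with rfl | ⟨y, hy⟩
  · simp
  obtain ⟨b, hb⟩ := exists_orthonormalBasis_norm_sq A
  -- In the coordinates of the right singular vectors, `S` lies in a box with half-sides `w i`: one
  -- constraint comes from `x - y`, the other from `A (x - y)`.
  set w : Fin d → ℝ := fun i => min R (r / singVal A i) with hw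
  have hw0 : ∀ i, 0 ≤ w i := fun i => le_min (by linarith) (div_nonneg hr.le (singVal_nonneg _ _))
  set B : Set (Fin d → ℝ) := Set.Icc (fun i => b.repr y i - w i) (fun i => b.repr y i + w i)
    with hB
  have hmp : MeasurePreserving (fun x : Space d => (WithLp.ofLp (b.repr x) : Fin d → ℝ)) :=
    (PiLp.volume_preserving_ofLp (Fin d)).comp b.measurePreserving_repr
  have hsub : S ⊆ (fun x : Space d => (WithLp.ofLp (b.repr x) : Fin d → ℝ)) ⁻¹' B := by
    intro x hx
    have key : ∀ i : Fin d, |b.repr x i - b.repr y i| ≤ w i := by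
      intro i
      have e1 : b.repr x i - b.repr y i = b.repr (x - y) i := by simp
      rw [e1]
      obtain ⟨h1, h2⟩ := hS x hx y hy
      refine le_min ?_ ?_
      · refine le_trans ?_ h1
        rw [← b.repr.norm_map]
        simpa using PiLp.norm_apply_le (b.repr (x - y)) i
      · rw [le_div_iff₀ (hA i i.2), mul_comm]
        refine le_trans ?_ h2
        refine abs_le_of_sq_le_sq' ?_ (norm_nonneg _) |>.2
        rw [hb, mul_pow, sq_abs, ← mul_pow]
        exact Finset.single_le_sum (f := fun i : Fin d => (singVal A i * b.repr (x - y) i) ^ 2)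
          (fun _ _ => sq_nonneg _) (Finset.mem_univ i)
    refine ⟨fun i => ?_, fun i => ?_⟩
    · have := (abs_le.1 (key i)).1
      simp only
      linarith
    · have := (abs_le.1 (key i)).2
      simp only
      linarith
  calc volume S ≤ volume ((fun x : Space d => (WithLp.ofLp (b.repr x) : Fin d → ℝ)) ⁻¹' B) :=
        measure_mono hsub
    _ = volume B := hmp.measure_preimage measurableSet_Icc.nullMeasurableSet
    _ = ENNReal.ofReal (∏ i : Fin d, 2 * w i) := by
        rw [hB, Real.volume_Icc_pi, ENNReal.ofReal_prod_of_nonneg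
          (fun i _ => mul_nonneg zero_le_two (hw0 i))]
        refine Finset.prod_congr rfl fun i _ => ?_
        congr 1; ring
    _ ≤ _ := by
        refine ENNReal.ofReal_le_ofReal ?_
        have e : (2 * R) ^ d * (r ^ (t : ℝ) / svf t A) =
            ∏ i : Fin d, (2 * R) * (r / singVal A i) ^ svExp t i := by
          have hrt : r ^ (t : ℝ) = ∏ i ∈ Finset.range d, r ^ svExp t i := by
            rw [← Real.rpow_sum_of_pos hr, sum_svExp hd ht]
          rw [Finset.prod_mul_distrib, svf_eq_prod hd ht, hrt, ← Finset.prod_div_distrib,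
            Fin.prod_univ_eq_prod_range (fun i => (r / singVal A i) ^ svExp t i)]
          simp only [Finset.prod_const, Finset.card_univ, Fintype.card_fin]
          congr 1
          refine Finset.prod_congr rfl fun i _ => ?_
          rw [Real.div_rpow hr.le (singVal_nonneg _ _)]
        rw [e]
        refine Finset.prod_le_prod (fun i _ => mul_nonneg zero_le_two (hw0 i)) fun i _ => ?_
        rw [mul_assoc]
        refine mul_le_mul_of_nonneg_left ?_ zero_le_two
        -- Since `R ≥ 1`, `min R q ≤ R * q ^ e` for every `e ∈ [0, 1]`; the cases are `q ≤ 1` and `q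
        -- > 1`.
        have hq : 0 < r / singVal A i := div_pos hr (hA i i.2)
        rcases le_or_gt (r / singVal A i) 1 with h | h
        · calc w i ≤ r / singVal A i := min_le_right _ _
            _ = (r / singVal A i) ^ (1 : ℝ) := (Real.rpow_one _).symm
            _ ≤ (r / singVal A i) ^ svExp t i :=
                Real.rpow_le_rpow_of_exponent_ge hq h (svExp_le_one _ _)
            _ ≤ _ := le_mul_of_one_le_left (Real.rpow_nonneg hq.le _) hR
        · calc w i ≤ R := min_le_left _ _
            _ ≤ _ := le_mul_of_one_le_right (by linarith)
                (Real.one_le_rpow h.le (svExp_nonneg _ _))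

/-- A bounded set is covered by few sets whose images under `A` have diameter comparable to
the `p`-th singular value. -/
theorem exists_cover_norm_le {A : Space d →L[ℝ] Space d} (hA : ∀ i < d, 0 < singVal A i)
    {p : ℕ} (hp : p < d) {ρ : ℝ} (hρ : 0 < ρ) {J : Set (Space d)} (hJ : ∀ x ∈ J, ‖x‖ ≤ ρ) :
    ∃ (N : ℕ) (F : Fin N → Set (Space d)), J ⊆ ⋃ k, F k ∧
      (N : ℝ) ≤ 3 ^ p * ∏ i ∈ Finset.range p, singVal A i / singVal A p ∧
      ∀ k, ∀ x ∈ F k, ∀ y ∈ F k, ‖A (x - y)‖ ≤ 2 * ρ * d * singVal A p := by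
  obtain ⟨b, hb⟩ := exists_orthonormalBasis_norm_sq A
  have hσp := hA p hp
  -- For `i < p`, the coordinate range `[-ρ, ρ]` is cut into intervals of length `ρ α_p / α_i`,
  -- which `A` stretches to `ρ α_p`; `q` is the rescaled coordinate and its floor labels the cell.
  -- Ratios at least `1` give at most `3 α_i / α_p` cells. The directions `i ≥ p` need no cutting.
  set M : Fin p → ℕ := fun i => ⌊2 * (singVal A i / singVal A p)⌋₊ + 1 with hM
  set c : Fin p → Fin d := fun i => ⟨i, i.2.trans hp⟩ with hc
  set q : Space d → Fin p → ℝ :=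
    fun x i => (b.repr x (c i) + ρ) / ρ * (singVal A i / singVal A p) with hq
  set G : ((i : Fin p) → Fin (M i)) → Set (Space d) :=
    fun k => {x | x ∈ J ∧ ∀ i, ⌊q x i⌋₊ = k i} with hG
  have hcoord : ∀ x ∈ J, ∀ i, |b.repr x i| ≤ ρ := by
    intro x hx i
    refine le_trans ?_ (hJ x hx)
    rw [← b.repr.norm_map]
    simpa using PiLp.norm_apply_le (b.repr x) i
  have hratio : ∀ i : Fin p, 1 ≤ singVal A i / singVal A p := fun i => by
    rw [le_div_iff₀ hσp, one_mul]
    exact singVal_antitone A i.2.le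
  have hq0 : ∀ x ∈ J, ∀ i, 0 ≤ q x i := fun x hx i => by
    have := (abs_le.1 (hcoord x hx (c i))).1
    exact mul_nonneg (div_nonneg (by linarith) hρ.le) (by linarith [hratio i])
  have hq1 : ∀ x ∈ J, ∀ i, q x i ≤ 2 * (singVal A i / singVal A p) := fun x hx i => by
    have := (abs_le.1 (hcoord x hx (c i))).2
    refine mul_le_mul_of_nonneg_right ?_ (by linarith [hratio i])
    rw [div_le_iff₀ hρ]
    linarith
  have hcov : J ⊆ ⋃ k, G k := by
    intro x hx
    refine Set.mem_iUnion.2 ⟨fun i => ⟨⌊q x i⌋₊, ?_⟩, hx, fun i => rfl⟩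
    exact Nat.lt_succ_of_le (Nat.floor_le_floor (hq1 x hx i))
  have hcard : (Fintype.card ((i : Fin p) → Fin (M i)) : ℝ) ≤
      3 ^ p * ∏ i ∈ Finset.range p, singVal A i / singVal A p := by
    rw [Fintype.card_pi, ← Fin.prod_univ_eq_prod_range (fun i => singVal A i / singVal A p)]
    have e : (3 : ℝ) ^ p * ∏ i : Fin p, singVal A i / singVal A p =
        ∏ i : Fin p, 3 * (singVal A i / singVal A p) := by
      rw [Finset.prod_mul_distrib]; simp
    rw [e]
    push_cast
    refine Finset.prod_le_prod (fun i _ => by positivity) fun i _ => ?_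
    simp only [Fintype.card_fin, hM]
    push_cast
    have := Nat.floor_le (a := 2 * (singVal A i / singVal A p)) (by linarith [hratio i])
    linarith [hratio i]
  have hdiff : ∀ k, ∀ x ∈ G k, ∀ y ∈ G k, ‖A (x - y)‖ ≤ 2 * ρ * d * singVal A p := by
    rintro k x ⟨hxJ, hx⟩ y ⟨hyJ, hy⟩
    have hterm : ∀ i : Fin d,
        (singVal A i * b.repr (x - y) i) ^ 2 ≤ (2 * ρ * singVal A p) ^ 2 := by
      intro i
      rw [sq_le_sq, abs_mul, abs_of_nonneg (singVal_nonneg A i),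
        abs_of_nonneg (by positivity : 0 ≤ 2 * ρ * singVal A p)]
      have e1 : b.repr (x - y) i = b.repr x i - b.repr y i := by simp
      rw [e1]
      rcases lt_or_ge (i : ℕ) p with hip | hip
      · have hci : c ⟨i, hip⟩ = i := rfl
        have h1 : |q x ⟨i, hip⟩ - q y ⟨i, hip⟩| ≤ 1 := by
          have hxi := hx ⟨i, hip⟩
          have hyi := hy ⟨i, hip⟩
          have a1 := Nat.floor_le (hq0 x hxJ ⟨i, hip⟩)
          have a2 := Nat.lt_floor_add_one (q x ⟨i, hip⟩)
          have a3 := Nat.floor_le (hq0 y hyJ ⟨i, hip⟩)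
          have a4 := Nat.lt_floor_add_one (q y ⟨i, hip⟩)
          rw [hxi] at a1 a2
          rw [hyi] at a3 a4
          rw [abs_le]
          constructor <;> linarith
        have h2 : singVal A i * |b.repr x i - b.repr y i| =
            |q x ⟨i, hip⟩ - q y ⟨i, hip⟩| * (ρ * singVal A p) := by
          rw [← abs_of_nonneg (singVal_nonneg A i), ← abs_mul,
            ← abs_of_nonneg (by positivity : 0 ≤ ρ * singVal A p), ← abs_mul]
          congr 1
          simp only [hq, hci]
          field_simp
          ring
        rw [h2]
        have : 0 < ρ * singVal A p := by positivity
        nlinarith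
      · have h1 := hcoord x hxJ i
        have h2 := hcoord y hyJ i
        have h3 : |b.repr x i - b.repr y i| ≤ 2 * ρ :=
          (abs_sub _ _).trans (by linarith)
        calc _ ≤ singVal A p * (2 * ρ) :=
              mul_le_mul (singVal_antitone A hip) h3 (abs_nonneg _) hσp.le
          _ = _ := by ring
    refine le_of_sq_le_sq ?_ (by positivity)
    rw [hb]
    calc _ ≤ ∑ _i : Fin d, (2 * ρ * singVal A p) ^ 2 := Finset.sum_le_sum fun i _ => hterm i
      _ = d * (2 * ρ * singVal A p) ^ 2 := by simp
      _ ≤ (d : ℝ) ^ 2 * (2 * ρ * singVal A p) ^ 2 := by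
          refine mul_le_mul_of_nonneg_right ?_ (sq_nonneg _)
          have : (1 : ℝ) ≤ d := by exact_mod_cast (by omega : 1 ≤ d)
          nlinarith
      _ = _ := by ring
  let e := Fintype.equivFin ((i : Fin p) → Fin (M i))
  refine ⟨_, fun k => G (e.symm k), ?_, hcard, fun k => hdiff _⟩
  intro x hx
  obtain ⟨k, hk⟩ := Set.mem_iUnion.1 (hcov hx)
  exact Set.mem_iUnion.2 ⟨e k, by simpa using hk⟩

end LinearAlgebra

/-! ### The tree of words and measures from random descent -/

section Words

variable {n : ℕ → ℕ}

/-- The word that extends `u` by the letter `j`. -/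
def Word.snoc {k : ℕ} (u : Word n k) (j : Fin (n k)) : Word n (k + 1) :=
  Fin.snoc (α := fun i : Fin (k + 1) => Fin (n i)) u j

@[simp] theorem Word.init_snoc {k : ℕ} (u : Word n k) (j : Fin (n k)) : (u.snoc j).init = u := by
  funext i
  exact Fin.snoc_castSucc (α := fun i : Fin (k + 1) => Fin (n i)) j u i

@[simp] theorem Word.last_snoc {k : ℕ} (u : Word n k) (j : Fin (n k)) : (u.snoc j).last = j :=
  Fin.snoc_last (α := fun i : Fin (k + 1) => Fin (n i)) j u

@[simp] theorem Word.snoc_init_last {k : ℕ} (u : Word n (k + 1)) : u.init.snoc u.last = u :=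
  Fin.snoc_init_self (α := fun i : Fin (k + 1) => Fin (n i)) u

/-- The prefix of length `k` of an infinite word. -/
def InfWord.take (v : InfWord n) (k : ℕ) : Word n k := fun i => v i

theorem InfWord.init_take (v : InfWord n) (k : ℕ) : (InfWord.take v (k + 1)).init =
    InfWord.take v k := rfl

theorem InfWord.last_take (v : InfWord n) (k : ℕ) : (InfWord.take v (k + 1)).last = v k := rfl

theorem mem_cylinder_iff {k : ℕ} {u : Word n k} {v : InfWord n} :
    v ∈ cylinder ⟨k, u⟩ ↔ InfWord.take v k = u :=
  ⟨fun h => funext h, fun h i => congrFun h i⟩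

theorem InfWord.take_succ_eq_iff (v : InfWord n) {k : ℕ} (u : Word n (k + 1)) :
    InfWord.take v (k + 1) = u ↔ InfWord.take v k = u.init ∧ v k = u.last := by
  constructor
  · rintro rfl
    exact ⟨rfl, rfl⟩
  · rintro ⟨h1, h2⟩
    rw [← u.snoc_init_last, ← h1, ← h2, ← InfWord.last_take v k, ← InfWord.init_take v k,
      Word.snoc_init_last]

theorem InfWord.take_eq_of_lt {v w : InfWord n} {k l : ℕ} (hkl : k < l)
    (h : InfWord.take v l = InfWord.take w l) : v k = w k :=
  congrFun h ⟨k, hkl⟩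

theorem measurable_take (k : ℕ) : Measurable fun v : InfWord n => InfWord.take v k :=
  measurable_pi_lambda _ fun _ => measurable_pi_apply _

theorem measurableSet_cylinder (u : FinWord n) : MeasurableSet (cylinder u) := by
  have : cylinder u = (fun v : InfWord n => InfWord.take v u.1) ⁻¹' {u.2} := by
    ext v
    exact mem_cylinder_iff
  rw [this]
  exact measurable_take _ (measurableSet_singleton _)

/-- The path in the tree of words that follows at each vertex `u` the edge with label `ξ u`. -/
def pathWord (ξ : (u : FinWord n) → Fin (n u.1)) : (k : ℕ) → Word n k
  | 0 => fun i => i.elim0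
  | k + 1 => (pathWord ξ k).snoc (ξ ⟨k, pathWord ξ k⟩)

/-- The infinite word read along the path that follows the edges labelled by `ξ`. -/
def path (ξ : (u : FinWord n) → Fin (n u.1)) : InfWord n := fun k => ξ ⟨k, pathWord ξ k⟩

theorem take_path (ξ : (u : FinWord n) → Fin (n u.1)) (k : ℕ) :
    InfWord.take (path ξ) k = pathWord ξ k := by
  induction k with
  | zero => exact funext fun i => i.elim0
  | succ k ih =>
    rw [InfWord.take_succ_eq_iff, ih]
    simp [pathWord, path]

theorem path_apply (ξ : (u : FinWord n) → Fin (n u.1)) (k : ℕ) :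
    path ξ k = ξ ⟨k, InfWord.take (path ξ) k⟩ := by
  rw [take_path]
  rfl

/-- The set of vertices on the way to the word `u`. -/
def Word.ancestors : {k : ℕ} → Word n k → Finset (FinWord n)
  | 0, _ => ∅
  | k + 1, u => insert ⟨k, u.init⟩ u.init.ancestors

theorem Word.length_lt_of_mem_ancestors {k : ℕ} (u : Word n k) {a : FinWord n}
    (ha : a ∈ u.ancestors) : a.1 < k := by
  induction k with
  | zero => simp [Word.ancestors] at ha
  | succ k ih =>
    rw [Word.ancestors, Finset.mem_insert] at ha
    rcases ha with rfl | ha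
    · exact Nat.lt_succ_self _
    · exact (ih _ ha).trans (Nat.lt_succ_self _)

/-- The edges that may be followed at `a` in order to get to `u`. -/
def Word.edgesToward {k : ℕ} (u : Word n k) (a : FinWord n) : Set (Fin (n a.1)) :=
  {j | ∀ h : a.1 < k, u ⟨a.1, h⟩ = j}

/-- Only the choices at the finitely many ancestors of `u` matter, so a cylinder pulls back to a
box, whose product measure is explicit. `edgesToward` looks only at the level of a vertex, which
suffices on ancestors. -/
theorem path_mem_cylinder_iff (ξ : (u : FinWord n) → Fin (n u.1)) {k : ℕ} (u : Word n k) :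
    path ξ ∈ cylinder ⟨k, u⟩ ↔ ξ ∈ (u.ancestors : Set (FinWord n)).pi u.edgesToward := by
  induction k with
  | zero =>
    simp [Word.ancestors, mem_cylinder_iff, Subsingleton.elim _ u]
  | succ k ih =>
    rw [mem_cylinder_iff, InfWord.take_succ_eq_iff, ← mem_cylinder_iff, ih, Word.ancestors,
      Finset.coe_insert, Set.insert_pi]
    have hiff : ξ ∈ (u.init.ancestors : Set (FinWord n)).pi u.init.edgesToward ↔
        ξ ∈ (u.init.ancestors : Set (FinWord n)).pi u.edgesToward := by
      refine forall₂_congr fun a ha => ?_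
      have hlt := u.init.length_lt_of_mem_ancestors ha
      exact ⟨fun h h' => h hlt, fun h h' => h (hlt.trans (Nat.lt_succ_self k))⟩
    rw [Set.mem_inter_iff, ← hiff, and_comm, ← ih]
    refine and_congr_left fun hmem => ?_
    rw [path_apply, mem_cylinder_iff.1 hmem]
    exact ⟨fun h _ => h.symm, fun h => (h (Nat.lt_succ_self k)).symm⟩

theorem measurable_path : Measurable (path (n := n)) := by
  refine measurable_pi_lambda _ fun k => measurable_to_countable' fun j => ?_
  have : (fun ξ : (u : FinWord n) → Fin (n u.1) => path ξ k) ⁻¹' {j} =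
      ⋃ u : Word n k, path ⁻¹' cylinder ⟨k + 1, u.snoc j⟩ := by
    ext ξ
    simp only [Set.mem_preimage, Set.mem_singleton_iff, Set.mem_iUnion, mem_cylinder_iff,
      InfWord.take_succ_eq_iff, Word.init_snoc, Word.last_snoc]
    exact ⟨fun h => ⟨_, rfl, h⟩, fun ⟨_, _, h⟩ => h⟩
  rw [this]
  refine MeasurableSet.iUnion fun u => ?_
  have e : path ⁻¹' cylinder ⟨k + 1, u.snoc j⟩ =
      ((u.snoc j).ancestors : Set (FinWord n)).pi (u.snoc j).edgesToward :=
    Set.ext fun ξ => path_mem_cylinder_iff ξ _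
  rw [e]
  exact MeasurableSet.pi (Finset.countable_toSet _) fun a _ => (Set.to_countable _).measurableSet

/-- There is a probability measure on the infinite words whose mass on cylinders is dominated by a
given finite subadditive function on the tree, normalized at the root. -/
theorem exists_measure_cylinder_le (hn : ∀ k, 2 ≤ n k) (g : (k : ℕ) → Word n k → ℝ≥0∞)
    (hfin : ∀ k u, g k u ≠ ∞) (hsub : ∀ k u, g k u ≤ ∑ j, g (k + 1) (u.snoc j)) :
    ∃ μ : Measure (InfWord n), IsProbabilityMeasure μ ∧
      ∀ k (u : Word n k), g 0 (fun i => i.elim0) * μ (cylinder ⟨k, u⟩) ≤ g k u := by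
  classical
  have hne : ∀ k, Nonempty (Fin (n k)) := fun k => ⟨⟨0, by linarith [hn k]⟩⟩
  set w : (a : FinWord n) → Fin (n a.1) → ℝ≥0∞ := fun a j => g (a.1 + 1) (a.2.snoc j) with hw
  have hwtop : ∀ a, tsum (w a) ≠ ∞ := fun a => by
    rw [tsum_fintype]
    exact ENNReal.sum_ne_top.2 fun j _ => hfin _ _
  -- Children are chosen with probability proportional to their weights. If these all vanish,
  -- subadditivity makes the weight of `a` vanish too, and any law will do.
  set p : (a : FinWord n) → PMF (Fin (n a.1)) := fun a =>
    if h : tsum (w a) = 0 then PMF.pure (hne a.1).some else PMF.normalize (w a) h (hwtop a)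
    with hp
  have hstep : ∀ (a : FinWord n) (j : Fin (n a.1)), g a.1 a.2 * p a j ≤ w a j := by
    intro a j
    have hle : g a.1 a.2 ≤ tsum (w a) := by
      rw [tsum_fintype]
      exact hsub _ _
    by_cases h : tsum (w a) = 0
    · rw [h] at hle
      rw [nonpos_iff_eq_zero.1 hle, zero_mul]
      exact zero_le
    · have e : p a = PMF.normalize (w a) h (hwtop a) := by simp only [hp, dif_neg h]
      rw [e, PMF.normalize_apply]
      calc _ ≤ tsum (w a) * (w a j * (tsum (w a))⁻¹) := by gcongr
        _ = w a j * (tsum (w a) * (tsum (w a))⁻¹) := by ring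
        _ = w a j := by rw [ENNReal.mul_inv_cancel h (hwtop a), mul_one]
  set Q : (a : FinWord n) → Measure (Fin (n a.1)) := fun a => (p a).toMeasure with hQ
  have hQp : ∀ a, IsProbabilityMeasure (Q a) := fun a => PMF.toMeasure.isProbabilityMeasure _
  refine ⟨(Measure.infinitePi Q).map path,
    Measure.isProbabilityMeasure_map measurable_path.aemeasurable, fun k u => ?_⟩
  have hprod : (Measure.infinitePi Q).map path (cylinder ⟨k, u⟩) =
      ∏ a ∈ u.ancestors, Q a (u.edgesToward a) := by
    rw [Measure.map_apply measurable_path (measurableSet_cylinder _)]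
    rw [show path ⁻¹' cylinder ⟨k, u⟩ = (u.ancestors : Set (FinWord n)).pi u.edgesToward from
      Set.ext fun ξ => path_mem_cylinder_iff ξ u]
    exact Measure.infinitePi_pi Q fun a _ => (Set.to_countable _).measurableSet
  rw [hprod]
  clear hprod
  induction k with
  | zero => simp [Word.ancestors, Subsingleton.elim (fun i => i.elim0) u]
  | succ k ih =>
    have hnot : (⟨k, u.init⟩ : FinWord n) ∉ u.init.ancestors := fun h =>
      lt_irrefl _ (u.init.length_lt_of_mem_ancestors h)
    rw [Word.ancestors, Finset.prod_insert hnot]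
    have e1 : ∏ a ∈ u.init.ancestors, Q a (u.edgesToward a) =
        ∏ a ∈ u.init.ancestors, Q a (u.init.edgesToward a) := by
      refine Finset.prod_congr rfl fun a ha => ?_
      have hlt := u.init.length_lt_of_mem_ancestors ha
      congr 1
      ext j
      exact ⟨fun h h' => h (hlt.trans (Nat.lt_succ_self k)), fun h h' => h hlt⟩
    have e2 : Q ⟨k, u.init⟩ (u.edgesToward ⟨k, u.init⟩) = p ⟨k, u.init⟩ u.last := by
      rw [← PMF.toMeasure_apply_singleton _ _ (measurableSet_singleton _)]
      congr 1
      ext j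
      exact ⟨fun h => (h (Nat.lt_succ_self k)).symm, fun h _ => (Set.mem_singleton_iff.1 h).symm⟩
    rw [e1, e2]
    calc _ = (g 0 (fun i => i.elim0) * ∏ a ∈ u.init.ancestors, Q a (u.init.edgesToward a)) *
          p ⟨k, u.init⟩ u.last := by ring
      _ ≤ g k u.init * p ⟨k, u.init⟩ u.last := by gcongr; exact ih _
      _ ≤ w ⟨k, u.init⟩ u.last := hstep ⟨k, u.init⟩ _
      _ = g (k + 1) u := by simp only [hw, Word.snoc_init_last]

end Words

/-! ### Net premeasures and a Frostman measure on words -/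

section NetMeasure

variable {d : ℕ} {n : ℕ → ℕ} (T : LinFamily d n) (s : ℝ≥0)

theorem netPremeasure_le_tsum {k : ℕ} {G : Set (InfWord n)} (A : Set (FinWord n))
    (hA : ∀ u ∈ A, k ≤ u.1) (hG : G ⊆ ⋃ u ∈ A, cylinder u) :
    netPremeasure T s k G ≤ ∑' u : A, ENNReal.ofReal (svf s (linComp T u.1.1 u.1.2)) := by
  unfold netPremeasure
  exact iInf_le_of_le A (iInf_le_of_le hA (iInf_le_of_le hG le_rfl))

theorem netPremeasure_cylinder_le {k : ℕ} (u : FinWord n) (hu : k ≤ u.1) :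
    netPremeasure T s k (cylinder u) ≤ ENNReal.ofReal (svf s (linComp T u.1 u.2)) := by
  refine (netPremeasure_le_tsum T s {u} ?_ ?_).trans ?_
  · rintro _ rfl
    exact hu
  · simp
  · rw [tsum_singleton u (fun u : FinWord n => ENNReal.ofReal (svf s (linComp T u.1 u.2)))]

theorem netPremeasure_mono {k : ℕ} {G H : Set (InfWord n)} (h : G ⊆ H) :
    netPremeasure T s k G ≤ netPremeasure T s k H :=
  iInf_mono fun _ => iInf_mono fun _ => iInf_mono' fun hH => ⟨h.trans hH, le_rfl⟩

theorem netPremeasure_iUnion_le {k : ℕ} {ι : Type*} [Fintype ι] (G : ι → Set (InfWord n)) :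
    netPremeasure T s k (⋃ i, G i) ≤ ∑ i, netPremeasure T s k (G i) := by
  have hmem : ∀ i, netPremeasure T s k (G i) ≠ ∞ → ∀ ε : ℝ≥0, 0 < ε →
      ∃ A : Set (FinWord n), (∀ u ∈ A, k ≤ u.1) ∧ G i ⊆ ⋃ u ∈ A, cylinder u ∧
        ∑' u : A, ENNReal.ofReal (svf s (linComp T u.1.1 u.1.2)) ≤
          netPremeasure T s k (G i) + ε := by
    intro i hi ε hε
    have hlt : netPremeasure T s k (G i) < netPremeasure T s k (G i) + ε :=
      ENNReal.lt_add_right hi (by exact_mod_cast hε.ne')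
    conv_lhs at hlt => unfold netPremeasure
    simp only [iInf_lt_iff] at hlt
    obtain ⟨A, h1, h2, h3⟩ := hlt
    exact ⟨A, h1, h2, h3.le⟩
  by_cases htop : ∃ i, netPremeasure T s k (G i) = ∞
  · obtain ⟨i, hi⟩ := htop
    rw [ENNReal.sum_eq_top.2 ⟨i, Finset.mem_univ i, hi⟩]
    exact le_top
  push Not at htop
  refine ENNReal.le_of_forall_pos_le_add fun ε hε _ => ?_
  have hε' : 0 < ε / (Fintype.card ι + 1) := by positivity
  choose A h1 h2 h3 using fun i => hmem i (htop i) _ hε'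
  refine (netPremeasure_le_tsum T s (⋃ i, A i) ?_ ?_).trans ?_
  · intro u hu
    obtain ⟨i, hi⟩ := Set.mem_iUnion.1 hu
    exact h1 i u hi
  · refine Set.iUnion_subset fun i => (h2 i).trans ?_
    exact Set.biUnion_subset_biUnion_left (Set.subset_iUnion A i)
  · calc _ ≤ ∑ i, ∑' u : A i, ENNReal.ofReal (svf s (linComp T u.1.1 u.1.2)) := by
          have := ENNReal.tsum_iUnion_le (fun u : FinWord n =>
            ENNReal.ofReal (svf s (linComp T u.1 u.2))) A
          exact this
      _ ≤ ∑ i, (netPremeasure T s k (G i) + (ε / (Fintype.card ι + 1) : ℝ≥0)) :=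
          Finset.sum_le_sum fun i _ => h3 i
      _ ≤ _ := by
          rw [Finset.sum_add_distrib]
          gcongr
          simp only [Finset.sum_const, Finset.card_univ, nsmul_eq_mul]
          norm_cast
          rw [← mul_div_assoc]
          refine div_le_of_le_mul₀ (by positivity) (by positivity) ?_
          rw [mul_comm]
          gcongr
          simp

/-- If the net measure of exponent `s` does not vanish, there is a probability measure on the
infinite words whose mass on long cylinders is controlled by `φ^s`. -/
theorem exists_frostman_measure (hn : ∀ k, 2 ≤ n k) (hs : netMeasure T s Set.univ ≠ 0) :
    ∃ μ : Measure (InfWord n), IsProbabilityMeasure μ ∧ ∃ (C : ℝ≥0) (k₀ : ℕ),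
      ∀ k (u : Word n k), k₀ ≤ k →
        μ (cylinder ⟨k, u⟩) ≤ C * ENNReal.ofReal (svf s (linComp T k u)) := by
  obtain ⟨k₀, hk₀⟩ : ∃ k, netPremeasure T s k Set.univ ≠ 0 := by
    by_contra! h
    exact hs (by simp [netMeasure, h])
  have huniv : (⋃ u : Word n k₀, cylinder ⟨k₀, u⟩ : Set (InfWord n)) = Set.univ :=
    Set.eq_univ_of_forall fun v => Set.mem_iUnion.2 ⟨_, mem_cylinder_iff.2 rfl⟩
  have htop : ∀ G, netPremeasure T s k₀ G ≠ ∞ := by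
    intro G
    refine ne_top_of_le_ne_top ?_ (netPremeasure_mono T s (Set.subset_univ G))
    rw [← huniv]
    refine ne_top_of_le_ne_top ?_ (netPremeasure_iUnion_le T s _)
    exact ENNReal.sum_ne_top.2 fun u _ =>
      ne_top_of_le_ne_top ENNReal.ofReal_ne_top (netPremeasure_cylinder_le T s _ le_rfl)
  -- The weight of `u` is the premeasure of its cylinder at the fixed level `k₀`. Covering the
  -- cylinder by itself bounds it by `φ^s(T_u)`, which is allowed only for words of length at least
  -- `k₀`; the constant is the inverse of the weight at the root.
  obtain ⟨μ, hμ, hle⟩ := exists_measure_cylinder_le hn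
    (fun k u => netPremeasure T s k₀ (cylinder ⟨k, u⟩)) (fun k u => htop _) (fun k u => by
      refine le_trans (netPremeasure_mono T s ?_) (netPremeasure_iUnion_le T s _)
      intro v hv
      refine Set.mem_iUnion.2 ⟨v k, mem_cylinder_iff.2 ((InfWord.take_succ_eq_iff _ _).2 ?_)⟩
      simpa using mem_cylinder_iff.1 hv)
  refine ⟨μ, hμ, (netPremeasure T s k₀ Set.univ)⁻¹.toNNReal, k₀, fun k u hk => ?_⟩
  have h1 := hle k u
  have h2 : (cylinder ⟨0, fun i => i.elim0⟩ : Set (InfWord n)) = Set.univ :=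
    Set.eq_univ_of_forall fun v i => i.elim0
  rw [h2] at h1
  rw [ENNReal.coe_toNNReal (ENNReal.inv_ne_top.2 hk₀), mul_comm, ← div_eq_mul_inv,
    ENNReal.le_div_iff_mul_le (Or.inl hk₀) (Or.inl (htop _)), mul_comm]
  exact h1.trans (netPremeasure_cylinder_le T s _ hk)

end NetMeasure

/-! ### Compositions along a word and the address map -/

section Compositions

variable {d : ℕ} {n : ℕ → ℕ} {T : LinFamily d n}

theorem norm_linComp_le {β : ℝ} (hβ : 0 ≤ β) (hup : ∀ k j x, ‖T k j x‖ ≤ β * ‖x‖) (k : ℕ)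
    (u : Word n k) (x : Space d) : ‖linComp T k u x‖ ≤ β ^ k * ‖x‖ := by
  induction k generalizing x with
  | zero => simp [linComp]
  | succ k ih =>
    calc ‖linComp T (k + 1) u x‖ = ‖linComp T k u.init (T k u.last x)‖ := rfl
      _ ≤ β ^ k * ‖T k u.last x‖ := ih _ _
      _ ≤ β ^ k * (β * ‖x‖) := by gcongr; exact hup _ _ _
      _ = _ := by ring

theorem le_norm_linComp {α : ℝ} (hα : 0 ≤ α) (hlow : ∀ k j x, α * ‖x‖ ≤ ‖T k j x‖) (k : ℕ)
    (u : Word n k) (x : Space d) : α ^ k * ‖x‖ ≤ ‖linComp T k u x‖ := by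
  induction k generalizing x with
  | zero => simp [linComp]
  | succ k ih =>
    calc α ^ (k + 1) * ‖x‖ = α ^ k * (α * ‖x‖) := by ring
      _ ≤ α ^ k * ‖T k u.last x‖ := by gcongr; exact hlow _ _ _
      _ ≤ ‖linComp T k u.init (T k u.last x)‖ := ih _ _

theorem singVal_linComp_pos {α : ℝ} (hα : 0 < α) (hlow : ∀ k j x, α * ‖x‖ ≤ ‖T k j x‖) (k : ℕ)
    (u : Word n k) : ∀ i < d, 0 < singVal (linComp T k u) i := fun _ hi =>
  (pow_pos hα k).trans_le (le_singVal_of_forall_le_norm (le_norm_linComp hα.le hlow k u) hi)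

/-- The maps `T_v` along an infinite word `v` factor through the shorter ones. -/
theorem exists_linComp_take_add {α : ℝ} (hα : 0 ≤ α) (hlow : ∀ k j x, α * ‖x‖ ≤ ‖T k j x‖)
    (hone : ∀ k j x, ‖T k j x‖ ≤ ‖x‖) (v : InfWord n) (k l : ℕ) :
    ∃ S : Space d →L[ℝ] Space d,
      linComp T (k + l) (InfWord.take v (k + l)) = (linComp T k (InfWord.take v k)).comp S ∧
        (∀ x, α ^ l * ‖x‖ ≤ ‖S x‖) ∧ ∀ x, ‖S x‖ ≤ ‖x‖ := by
  induction l with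
  | zero => exact ⟨ContinuousLinearMap.id ℝ _, rfl, by simp, by simp⟩
  | succ l ih =>
    obtain ⟨S, h1, h2, h3⟩ := ih
    refine ⟨S.comp (T (k + l) (v (k + l))), ?_, fun x => ?_, fun x => ?_⟩
    · rw [← ContinuousLinearMap.comp_assoc, ← h1]
      rfl
    · calc α ^ (l + 1) * ‖x‖ = α ^ l * (α * ‖x‖) := by ring
        _ ≤ α ^ l * ‖T (k + l) (v (k + l)) x‖ := by gcongr; exact hlow _ _ _
        _ ≤ _ := h2 _
    · exact (h3 _).trans (hone _ _ _)

/-- Write `T_{v|k+l} = T_{v|k} U` with `U` nonexpanding and `|det U| ≥ α^{ld}`. The volume estimate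
for `T_{v|k}` applies to `U '' S`, and the return to `S` costs the determinant. -/
theorem volume_le_of_linComp_add (hd : 0 < d) {α : ℝ} (hα : 0 < α)
    (hlow : ∀ k j x, α * ‖x‖ ≤ ‖T k j x‖) (hone : ∀ k j x, ‖T k j x‖ ≤ ‖x‖) (v : InfWord n)
    (k l : ℕ) {t : ℝ≥0} (ht : t ≤ d) {R r : ℝ} (hR : 1 ≤ R) (hr : 0 < r) {S : Set (Space d)}
    (hS : ∀ x ∈ S, ∀ y ∈ S, ‖x - y‖ ≤ R ∧
      ‖linComp T (k + l) (InfWord.take v (k + l)) (x - y)‖ ≤ r) :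
    volume S ≤ ENNReal.ofReal (((α ^ l) ^ d)⁻¹) *
      ENNReal.ofReal ((2 * R) ^ d * (r ^ (t : ℝ) / svf t (linComp T k (InfWord.take v k)))) := by
  obtain ⟨U, h1, h2, h3⟩ := exists_linComp_take_add hα.le hlow hone v k l
  have himg : volume (U '' S) ≤ ENNReal.ofReal
      ((2 * R) ^ d * (r ^ (t : ℝ) / svf t (linComp T k (InfWord.take v k)))) := by
    refine volume_le_div_svf (singVal_linComp_pos hα hlow _ _) hd ht hR hr ?_
    rintro _ ⟨x, hx, rfl⟩ _ ⟨y, hy, rfl⟩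
    obtain ⟨h4, h5⟩ := hS x hx y hy
    rw [← map_sub]
    refine ⟨(h3 _).trans h4, ?_⟩
    rwa [h1] at h5
  have hdet : (α ^ l) ^ d ≤ |LinearMap.det (U : Space d →ₗ[ℝ] Space d)| := by
    rw [abs_det_eq_prod_singVal]
    calc (α ^ l) ^ d = ∏ _i ∈ Finset.range d, α ^ l := by simp
      _ ≤ _ := Finset.prod_le_prod (fun _ _ => (pow_pos hα l).le) fun i hi =>
          le_singVal_of_forall_le_norm h2 (Finset.mem_range.1 hi)
  rw [Measure.addHaar_image_continuousLinearMap] at himg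
  have hpos : 0 < (α ^ l) ^ d := by positivity
  calc volume S = ENNReal.ofReal (((α ^ l) ^ d)⁻¹) * (ENNReal.ofReal ((α ^ l) ^ d) * volume S) := by
        rw [← mul_assoc, ← ENNReal.ofReal_mul (by positivity), inv_mul_cancel₀ hpos.ne']
        simp
    _ ≤ _ := by
        gcongr
        refine le_trans ?_ himg
        gcongr

theorem affComp_eq_add (ω : FinWord n → Space d) (k : ℕ) (u : Word n k) (x : Space d) :
    affComp T ω k u x = linComp T k u x + affComp T ω k u 0 := by
  induction k generalizing x with
  | zero => simp [affComp, linComp]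
  | succ k ih =>
    simp only [affComp]
    rw [ih, ih u.init (T k u.last 0 + _)]
    simp only [linComp, ContinuousLinearMap.comp_apply, map_add, map_zero, zero_add]
    abel

theorem affComp_take_succ (ω : FinWord n → Space d) (v : InfWord n) (k : ℕ) :
    affComp T ω (k + 1) (InfWord.take v (k + 1)) 0 = affComp T ω k (InfWord.take v k) 0 +
      linComp T k (InfWord.take v k) (ω ⟨k + 1, InfWord.take v (k + 1)⟩) := by
  simp only [affComp]
  rw [affComp_eq_add, InfWord.init_take, map_zero, zero_add, add_comm]

theorem affComp_take_congr {ω ω' : FinWord n → Space d} (v : InfWord n) (k : ℕ)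
    (h : ∀ l < k, ω ⟨l + 1, InfWord.take v (l + 1)⟩ = ω' ⟨l + 1, InfWord.take v (l + 1)⟩) :
    affComp T ω k (InfWord.take v k) 0 = affComp T ω' k (InfWord.take v k) 0 := by
  induction k with
  | zero => rfl
  | succ k ih =>
    rw [affComp_take_succ, affComp_take_succ, ih fun l hl => h l (hl.trans (Nat.lt_succ_self k)),
      h k (Nat.lt_succ_self k)]

variable (T) in
/-- The point of the Moran set with address `v`. -/
def limitPoint (ω : FinWord n → Space d) (v : InfWord n) : Space d :=
  limUnder atTop fun k => affComp T ω k (InfWord.take v k) 0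

theorem tendsto_limitPoint {β : ℝ} (hβ : 0 ≤ β) (hβ1 : β < 1)
    (hup : ∀ k j x, ‖T k j x‖ ≤ β * ‖x‖) {ω : FinWord n → Space d} {R : ℝ}
    (hω : ∀ u, ‖ω u‖ ≤ R) (v : InfWord n) :
    Tendsto (fun k => affComp T ω k (InfWord.take v k) 0) atTop (𝓝 (limitPoint T ω v)) := by
  refine tendsto_nhds_limUnder (cauchySeq_tendsto_of_complete ?_)
  refine cauchySeq_of_le_geometric β R hβ1 fun k => ?_
  rw [dist_eq_norm, affComp_take_succ, sub_add_cancel_left, norm_neg, mul_comm]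
  refine (norm_linComp_le hβ hup _ _ _).trans ?_
  gcongr
  exact hω _

theorem limitPoint_congr {ω ω' : FinWord n → Space d} (v : InfWord n)
    (h : ∀ l, ω ⟨l + 1, InfWord.take v (l + 1)⟩ = ω' ⟨l + 1, InfWord.take v (l + 1)⟩) :
    limitPoint T ω v = limitPoint T ω' v := by
  unfold limitPoint
  congr 1
  funext k
  exact affComp_take_congr v k fun l _ => h l

/-- The limit point is the series `∑ T_{v|m} ω_{v|m+1}`, so changing one translation changes one
term. -/
theorem limitPoint_sub {β : ℝ} (hβ : 0 ≤ β) (hβ1 : β < 1)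
    (hup : ∀ k j x, ‖T k j x‖ ≤ β * ‖x‖) {ω ω' : FinWord n → Space d} {R : ℝ}
    (hω : ∀ u, ‖ω u‖ ≤ R) (hω' : ∀ u, ‖ω' u‖ ≤ R) (v : InfWord n) (m : ℕ)
    (h : ∀ l ≠ m, ω ⟨l + 1, InfWord.take v (l + 1)⟩ = ω' ⟨l + 1, InfWord.take v (l + 1)⟩) :
    limitPoint T ω v - limitPoint T ω' v = linComp T m (InfWord.take v m)
      (ω ⟨m + 1, InfWord.take v (m + 1)⟩ - ω' ⟨m + 1, InfWord.take v (m + 1)⟩) := by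
  have hlim := (tendsto_limitPoint hβ hβ1 hup hω v).sub (tendsto_limitPoint hβ hβ1 hup hω' v)
  refine tendsto_nhds_unique hlim (tendsto_const_nhds.congr' ?_)
  filter_upwards [eventually_ge_atTop (m + 1)] with k hk
  induction k, hk using Nat.le_induction with
  | base =>
    rw [affComp_take_succ, affComp_take_succ, affComp_take_congr v m fun l hl => h l hl.ne, map_sub]
    abel
  | succ k hk ih =>
    rw [affComp_take_succ, affComp_take_succ, h k (by omega), ih]
    abel

end Compositions

/-! ### Joint measurability of the address map -/

section Measurability

variable {d : ℕ} {n : ℕ → ℕ} (T : LinFamily d n)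

theorem measurable_affComp (k : ℕ) (u : Word n k) :
    Measurable fun ω : FinWord n → Space d => affComp T ω k u 0 := by
  induction k with
  | zero => exact measurable_const
  | succ k ih =>
    have : (fun ω : FinWord n → Space d => affComp T ω (k + 1) u 0) =
        fun ω => linComp T k u.init (ω ⟨k + 1, u⟩) + affComp T ω k u.init 0 := by
      funext ω
      simp only [affComp]
      rw [affComp_eq_add, map_zero, zero_add]
    rw [this]
    have h1 : Measurable fun ω : FinWord n → Space d => linComp T k u.init (ω ⟨k + 1, u⟩) :=
      (linComp T k u.init).measurable.comp
        (measurable_pi_apply (X := fun _ : FinWord n => Space d) ⟨k + 1, u⟩)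
    exact h1.add (ih u.init)

theorem measurable_limitPoint :
    Measurable fun q : (FinWord n → Space d) × InfWord n => limitPoint T q.1 q.2 := by
  refine (StronglyMeasurable.limUnder fun k => ?_).measurable
  refine Measurable.stronglyMeasurable ?_
  have h1 : Measurable fun q : (FinWord n → Space d) × Word n k => affComp T q.1 k q.2 0 :=
    measurable_from_prod_countable_left fun u => measurable_affComp T k u
  exact h1.comp (measurable_fst.prodMk ((measurable_take k).comp measurable_snd))

end Measurability

/-! ### Resampling a coordinate; bounded densities -/

section Resampling

/-- Resampling one coordinate preserves a product measure. -/
theorem map_update_infinitePi {ι : Type*} [DecidableEq ι] {X : ι → Type*}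
    [∀ i, MeasurableSpace (X i)] (P : (i : ι) → Measure (X i)) [∀ i, IsProbabilityMeasure (P i)]
    (a : ι) :
    ((Measure.infinitePi P).prod (P a)).map (fun q => Function.update q.1 a q.2) =
      Measure.infinitePi P := by
  refine Measure.eq_infinitePi P fun s t ht => ?_
  have hmeas : Measurable fun q : ((i : ι) → X i) × X a => Function.update q.1 a q.2 :=
    measurable_update'
  rw [Measure.map_apply hmeas (MeasurableSet.pi (Finset.countable_toSet _) fun i _ => ht i)]
  by_cases ha : a ∈ s
  · have e : (fun q : ((i : ι) → X i) × X a => Function.update q.1 a q.2) ⁻¹'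
        ((s : Set ι).pi t) = (((s.erase a : Finset ι) : Set ι).pi t) ×ˢ t a := by
      ext ⟨ω, x⟩
      simp only [Set.mem_preimage, Set.mem_pi, Set.mem_prod, Finset.mem_coe, Finset.mem_erase]
      constructor
      · intro h
        refine ⟨fun i hi => ?_, ?_⟩
        · simpa [Function.update_of_ne hi.1] using h i hi.2
        · simpa using h a ha
      · rintro ⟨h1, h2⟩ i hi
        by_cases hia : i = a
        · subst hia
          simpa using h2
        · simpa [Function.update_of_ne hia] using h1 i ⟨hia, hi⟩
    rw [e, Measure.prod_prod, Measure.infinitePi_pi P (fun i _ => ht i),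
      Finset.prod_erase_mul _ _ ha]
  · have e : (fun q : ((i : ι) → X i) × X a => Function.update q.1 a q.2) ⁻¹'
        ((s : Set ι).pi t) = ((s : Set ι).pi t) ×ˢ Set.univ := by
      ext ⟨ω, x⟩
      simp only [Set.mem_preimage, Set.mem_pi, Set.mem_prod, Finset.mem_coe, Set.mem_univ,
        and_true]
      refine forall₂_congr fun i hi => ?_
      have hia : i ≠ a := fun h => ha (h ▸ hi)
      rw [Function.update_of_ne hia]
    rw [e, Measure.prod_prod, Measure.infinitePi_pi P (fun i _ => ht i), measure_univ, mul_one]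

/-- An absolutely continuous probability measure has bounded density off a set of small measure. -/
theorem exists_bounded_density {E : Type*} [MeasurableSpace E] {ν P : Measure E} [SigmaFinite ν]
    [IsProbabilityMeasure P] (hac : P ≪ ν) {ε : ℝ≥0∞} (hε : 0 < ε) :
    ∃ (G : Set E) (c : ℝ≥0), MeasurableSet G ∧ P Gᶜ ≤ ε ∧ ∀ B, P (B ∩ G) ≤ c * ν B := by
  set f := P.rnDeriv ν with hf
  have hfm : Measurable f := Measure.measurable_rnDeriv _ _
  have hP : ν.withDensity f = P := Measure.withDensity_rnDeriv_eq _ _ hac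
  -- The superlevel sets of the density decrease to a null set, so one of them has mass below `ε`;
  -- its complement is `G`.
  set H : ℕ → Set E := fun m => {x | (m : ℝ≥0∞) < f x} with hH
  have hHm : ∀ m, MeasurableSet (H m) := fun m => measurableSet_lt measurable_const hfm
  have hanti : Antitone H := fun m m' h x (hx : (m' : ℝ≥0∞) < f x) =>
    show (m : ℝ≥0∞) < f x from lt_of_le_of_lt (by exact_mod_cast h) hx
  have hlim := tendsto_measure_iInter_atTop (μ := P) (fun m => (hHm m).nullMeasurableSet) hanti
    ⟨0, measure_ne_top _ _⟩
  have hnull : P (⋂ m, H m) = 0 := by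
    refine measure_mono_null (t := {x | ¬ f x < ∞}) ?_ (hac (ae_iff.1 (P.rnDeriv_lt_top ν)))
    intro x hx hlt
    obtain ⟨m, hm⟩ := ENNReal.exists_nat_gt hlt.ne
    exact lt_asymm hm (Set.mem_iInter.1 hx m)
  rw [hnull] at hlim
  obtain ⟨m, hm⟩ := (hlim.eventually (gt_mem_nhds hε)).exists
  refine ⟨(H m)ᶜ, m, (hHm m).compl, by simpa using hm.le, fun B => ?_⟩
  rw [← hP, withDensity_apply' _ _]
  calc ∫⁻ x in B ∩ (H m)ᶜ, f x ∂ν ≤ ∫⁻ _x in B ∩ (H m)ᶜ, (m : ℝ≥0∞) ∂ν :=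
        setLIntegral_mono measurable_const fun x hx => not_lt.1 hx.2
    _ = m * ν (B ∩ (H m)ᶜ) := by simp
    _ ≤ _ := by
        push_cast
        gcongr
        exact Set.inter_subset_left

end Resampling

/-! ### Transversality -/

section Transversality

variable {d : ℕ} {n : ℕ → ℕ} {T : LinFamily d n}

/-- The event that all translations are bounded by `R` and the points with addresses `v` and `v'`
are at distance at most `r`. -/
def closeEvent (T : LinFamily d n) (R : ℝ) (v v' : InfWord n) (r : ℝ) :
    Set (FinWord n → Space d) :=
  {ω | (∀ u, ‖ω u‖ ≤ R) ∧ dist (limitPoint T ω v) (limitPoint T ω v') ≤ r}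

theorem measurableSet_bounded (R : ℝ) :
    MeasurableSet {ω : FinWord n → Space d | ∀ u, ‖ω u‖ ≤ R} := by
  rw [Set.ofPred_forall]
  exact MeasurableSet.iInter fun u =>
    measurableSet_le (measurable_pi_apply u).norm measurable_const

theorem measurableSet_closeEvent (R : ℝ) (v v' : InfWord n) (r : ℝ) :
    MeasurableSet (closeEvent T R v v' r) := by
  have h : ∀ v : InfWord n, Measurable fun ω : FinWord n → Space d => limitPoint T ω v := by
    intro v
    have hv : Measurable fun ω : FinWord n → Space d => (ω, v) := measurable_prodMk_right
    simpa only [Function.comp_def] using (measurable_limitPoint T).comp hv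
  exact (measurableSet_bounded R).inter
    (measurableSet_le ((h v).dist (h v')) measurable_const)

theorem measure_forall_lt_notMem (P : Measure (Space d)) [IsProbabilityMeasure P]
    {G : Set (Space d)} (hG : MeasurableSet G) {w : ℕ → FinWord n} (hw : Function.Injective w)
    (l : ℕ) :
    Measure.infinitePi (fun _ : FinWord n => P) {ω | ∀ i < l, ω (w i) ∉ G} = P Gᶜ ^ l := by
  classical
  have e : {ω : FinWord n → Space d | ∀ i < l, ω (w i) ∉ G} =
      (((Finset.range l).image w : Finset (FinWord n)) : Set (FinWord n)).pi fun _ => Gᶜ := by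
    ext ω
    simp [Set.mem_pi]
  rw [e, Measure.infinitePi_pi _ fun _ _ => hG.compl]
  rw [Finset.prod_image fun i _ j _ h => hw h]
  simp

/-- The probability of proximity on the event that the `l`-th translation after the separation of
the two words is the first one in the set `G` of bounded density. -/
theorem measure_closeEvent_inter_le (hd : 0 < d) {α β : ℝ} (hα : 0 < α) (hβ : 0 ≤ β)
    (hβ1 : β < 1) (hlow : ∀ k j x, α * ‖x‖ ≤ ‖T k j x‖) (hup : ∀ k j x, ‖T k j x‖ ≤ β * ‖x‖)
    (P : Measure (Space d)) [IsProbabilityMeasure P] {G : Set (Space d)} (hG : MeasurableSet G)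
    {c : ℝ≥0} (hc : ∀ B, P (B ∩ G) ≤ c * volume B) {R : ℝ} (hR : 1 ≤ R) {t : ℝ≥0} (ht : t ≤ d)
    {v v' : InfWord n} {k : ℕ} (hne : v k ≠ v' k) {r : ℝ} (hr : 0 < r) (l : ℕ) :
    Measure.infinitePi (fun _ : FinWord n => P) (closeEvent T R v v' r ∩
        {ω | ∀ i < l, ω ⟨k + i + 1, InfWord.take v (k + i + 1)⟩ ∉ G} ∩
          {ω | ω ⟨k + l + 1, InfWord.take v (k + l + 1)⟩ ∈ G}) ≤
      P Gᶜ ^ l * (c * (ENNReal.ofReal (((α ^ l) ^ d)⁻¹) *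
        ENNReal.ofReal ((2 * (2 * R)) ^ d *
          ((2 * r) ^ (t : ℝ) / svf t (linComp T k (InfWord.take v k)))))) := by
  classical
  set w : ℕ → FinWord n := fun i => ⟨k + i + 1, InfWord.take v (k + i + 1)⟩ with hw
  have hwinj : Function.Injective w := fun i j h => by
    have := congrArg Sigma.fst h
    simp only [hw] at this
    omega
  set bad : Set (FinWord n → Space d) := {ω | ∀ i < l, ω (w i) ∉ G} with hbad
  set F := closeEvent T R v v' r ∩ bad ∩ {ω | ω (w l) ∈ G} with hF
  have hbadm : MeasurableSet bad := by
    simp only [hbad, Set.ofPred_forall]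
    exact MeasurableSet.iInter fun i => MeasurableSet.iInter fun _ =>
      measurable_pi_apply (X := fun _ : FinWord n => Space d) (w i) hG.compl
  have hFm : MeasurableSet F :=
    ((measurableSet_closeEvent R v v' r).inter hbadm).inter 
      (measurable_pi_apply (X := fun _ : FinWord n => Space d) (w l) hG)
  have hone : ∀ k j x, ‖T k j x‖ ≤ ‖x‖ := fun k j x =>
    (hup k j x).trans (mul_le_of_le_one_left (norm_nonneg _) hβ1.le)
  set K := ENNReal.ofReal (((α ^ l) ^ d)⁻¹) * ENNReal.ofReal ((2 * (2 * R)) ^ d *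
          ((2 * r) ^ (t : ℝ) / svf t (linComp T k (InfWord.take v k)))) with hK
  have hmeas : Measurable fun q : (FinWord n → Space d) × Space d =>
      Function.update q.1 (w l) q.2 := measurable_update'
  -- With the coordinates other than `w l` frozen, the fibre of `F` is empty off `bad`, which
  -- concerns only the coordinates `w i`, `i < l`; over `bad` it lies in `G` and in a set of small
  -- volume.
  have hfiber : ∀ ω : FinWord n → Space d,
      P ((fun x => Function.update ω (w l) x) ⁻¹' F) ≤ bad.indicator (fun _ => c * K) ω := by
    intro ω
    by_cases hωb : ω ∈ bad
    · rw [Set.indicator_of_mem hωb]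
      set S : Set (Space d) := {x | Function.update ω (w l) x ∈ closeEvent T R v v' r} with hS
      have hsub : (fun x => Function.update ω (w l) x) ⁻¹' F ⊆ S ∩ G := by
        rintro x ⟨⟨h1, -⟩, h2⟩
        exact ⟨h1, by simpa using h2⟩
      refine (measure_mono hsub).trans ((hc S).trans ?_)
      gcongr
      refine volume_le_of_linComp_add hd hα hlow hone v k l ht (by linarith) (by linarith) ?_
      intro x hx y hy
      have hxR : ‖x‖ ≤ R := by simpa using hx.1 (w l)
      have hyR : ‖y‖ ≤ R := by simpa using hy.1 (w l)
      refine ⟨(norm_sub_le _ _).trans (by linarith), ?_⟩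
      have h1 : limitPoint T (Function.update ω (w l) x) v -
          limitPoint T (Function.update ω (w l) y) v =
            linComp T (k + l) (InfWord.take v (k + l)) (x - y) := by
        rw [limitPoint_sub hβ hβ1 hup hx.1 hy.1 v (k + l)]
        · simp [hw]
        · intro m hm
          have : (⟨m + 1, InfWord.take v (m + 1)⟩ : FinWord n) ≠ w l := fun h => by
            have := congrArg Sigma.fst h
            simp only [hw] at this
            omega
          rw [Function.update_of_ne this, Function.update_of_ne this]
      -- The prefix `w l` of `v` contains position `k`, where `v'` differs, so it is not a prefix of
      -- `v'`.
      have h2 : limitPoint T (Function.update ω (w l) x) v' =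
          limitPoint T (Function.update ω (w l) y) v' := by
        refine limitPoint_congr v' fun m => ?_
        have : (⟨m + 1, InfWord.take v' (m + 1)⟩ : FinWord n) ≠ w l := fun h => by
          obtain rfl : m = k + l := by
            have := congrArg Sigma.fst h
            simp only [hw] at this
            omega
          have h' : InfWord.take v' (k + l + 1) = InfWord.take v (k + l + 1) :=
            eq_of_heq (Sigma.mk.inj h).2
          exact hne (InfWord.take_eq_of_lt (by omega) h').symm
        rw [Function.update_of_ne this, Function.update_of_ne this]
      rw [← h1]
      have hx2 := hx.2
      have hy2 := hy.2
      rw [← h2] at hy2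
      rw [← dist_eq_norm]
      -- Both positions of the first point are within `r` of the same second point; hence `2 * r`.
      calc _ ≤ _ := dist_triangle_right _ _ _
        _ ≤ 2 * r := by linarith
    · rw [Set.indicator_of_notMem hωb]
      have : (fun x => Function.update ω (w l) x) ⁻¹' F = ∅ := by
        refine Set.eq_empty_of_forall_notMem fun x hx => hωb fun i hi => ?_
        have : Function.update ω (w l) x (w i) ∉ G := hx.1.2 i hi
        rwa [Function.update_of_ne (fun h => hi.ne (hwinj h))] at this
      rw [this, measure_empty]
  calc Measure.infinitePi (fun _ : FinWord n => P) F
      = ((Measure.infinitePi (fun _ : FinWord n => P)).prod P)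
          ((fun q => Function.update q.1 (w l) q.2) ⁻¹' F) := by
        conv_lhs => rw [← map_update_infinitePi (fun _ : FinWord n => P) (w l)]
        exact Measure.map_apply hmeas hFm
    _ = ∫⁻ ω, P ((fun x => Function.update ω (w l) x) ⁻¹' F)
          ∂(Measure.infinitePi (fun _ : FinWord n => P)) :=
        Measure.prod_apply (hmeas hFm)
    _ ≤ ∫⁻ ω, bad.indicator (fun _ => c * K) ω
          ∂(Measure.infinitePi (fun _ : FinWord n => P)) := lintegral_mono hfiber
    _ = P Gᶜ ^ l * (c * K) := by
        rw [lintegral_indicator_const hbadm, measure_forall_lt_notMem P hG hwinj, mul_comm]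

/-- The probability that two points of the random Moran set are close. -/
theorem exists_measure_closeEvent_le (hd : 0 < d) {α β : ℝ} (hα : 0 < α) (hβ : 0 ≤ β)
    (hβ1 : β < 1) (hlow : ∀ k j x, α * ‖x‖ ≤ ‖T k j x‖) (hup : ∀ k j x, ‖T k j x‖ ≤ β * ‖x‖)
    (P : Measure (Space d)) [IsProbabilityMeasure P] (hP : P ≪ volume) {R : ℝ} (hR : 1 ≤ R)
    {t : ℝ≥0} (ht : t ≤ d) :
    ∃ C : ℝ≥0, ∀ (v v' : InfWord n) (k : ℕ), v k ≠ v' k → ∀ r : ℝ, 0 < r →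
      Measure.infinitePi (fun _ : FinWord n => P) (closeEvent T R v v' r) ≤
        C * ENNReal.ofReal (r ^ (t : ℝ)) *
          (ENNReal.ofReal (svf t (linComp T k (InfWord.take v k))))⁻¹ := by
  have hαd : 0 < α ^ d * 2⁻¹ := by positivity
  -- The value `α ^ d / 2` absorbs the determinant loss and leaves `2^{-l}`; the value `1/2` makes
  -- it a null event never to meet `G`.
  have hε : 0 < min (ENNReal.ofReal (α ^ d * 2⁻¹)) (2⁻¹ : ℝ≥0∞) :=
    lt_min (ENNReal.ofReal_pos.2 hαd) (by simp)
  obtain ⟨G, c, hG, hGε, hc⟩ := exists_bounded_density hP hε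
  -- The leading `2` is `∑ 2^{-l}`; the rest comes from the volume bound with `2 * R` and `2 * r` in
  -- place of `R` and `r`.
  refine ⟨2 * c * Real.toNNReal ((2 * (2 * R)) ^ d * 2 ^ (t : ℝ)), fun v v' k hne r hr => ?_⟩
  set w : ℕ → FinWord n := fun i => ⟨k + i + 1, InfWord.take v (k + i + 1)⟩ with hw
  have hwinj : Function.Injective w := fun i j h => by
    have := congrArg Sigma.fst h
    simp only [hw] at this
    omega
  set Q := Measure.infinitePi (fun _ : FinWord n => P) with hQ
  set F : ℕ → Set (FinWord n → Space d) := fun l => closeEvent T R v v' r ∩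
    {ω | ∀ i < l, ω (w i) ∉ G} ∩ {ω | ω (w l) ∈ G} with hF
  have hnull : Q {ω | ∀ i, ω (w i) ∉ G} = 0 := by
    have hle : ∀ l : ℕ, Q {ω | ∀ i, ω (w i) ∉ G} ≤ (2⁻¹ : ℝ≥0∞) ^ l := fun l =>
      calc _ ≤ Q {ω | ∀ i < l, ω (w i) ∉ G} := measure_mono (Set.ofPred_subset_ofPred.2 fun ω hω i _ => hω i)
        _ = P Gᶜ ^ l := measure_forall_lt_notMem P hG hwinj l
        _ ≤ _ := by gcongr; exact hGε.trans (min_le_right _ _)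
    refine le_antisymm (ge_of_tendsto' (ENNReal.tendsto_pow_atTop_nhds_zero_of_lt_one ?_) hle)
      zero_le
    exact ENNReal.inv_lt_one.2 (by norm_num)
  have hcover : closeEvent T R v v' r ⊆ (⋃ l, F l) ∪ {ω | ∀ i, ω (w i) ∉ G} := by
    classical
    intro ω hω
    by_cases h : ∃ i, ω (w i) ∈ G
    · exact Or.inl (Set.mem_iUnion.2 ⟨Nat.find h, ⟨hω, fun i hi => Nat.find_min h hi⟩,
        Nat.find_spec h⟩)
    · exact Or.inr fun i hi => h ⟨i, hi⟩
  set φ := svf t (linComp T k (InfWord.take v k)) with hφ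
  have hφ0 : 0 < φ := svf_pos (singVal_linComp_pos hα hlow _ _) hd t
  have hterm : ∀ l, Q (F l) ≤ (2⁻¹ : ℝ≥0∞) ^ l * (c * ENNReal.ofReal ((2 * (2 * R)) ^ d *
          ((2 * r) ^ (t : ℝ) / φ))) := by
    intro l
    refine (measure_closeEvent_inter_le hd hα hβ hβ1 hlow hup P hG hc hR ht hne hr l).trans ?_
    have hp : P Gᶜ ^ l * ENNReal.ofReal (((α ^ l) ^ d)⁻¹) ≤ (2⁻¹ : ℝ≥0∞) ^ l := by
      calc _ ≤ (ENNReal.ofReal (α ^ d * 2⁻¹)) ^ l * ENNReal.ofReal (((α ^ l) ^ d)⁻¹) := by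
            gcongr
            exact hGε.trans (min_le_left _ _)
        _ = (2⁻¹ : ℝ≥0∞) ^ l := by
            rw [← ENNReal.ofReal_pow hαd.le, ← ENNReal.ofReal_mul (by positivity)]
            have e : (α ^ d * 2⁻¹) ^ l * ((α ^ l) ^ d)⁻¹ = (2⁻¹ : ℝ) ^ l := by
              rw [mul_pow, ← pow_mul, ← pow_mul, mul_comm d l]
              field_simp
            rw [e, ENNReal.ofReal_pow (by norm_num), ENNReal.ofReal_inv_of_pos two_pos]
            simp
    calc _ = (P Gᶜ ^ l * ENNReal.ofReal (((α ^ l) ^ d)⁻¹)) * (c * ENNReal.ofReal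
            ((2 * (2 * R)) ^ d * ((2 * r) ^ (t : ℝ) / φ))) := by ring
      _ ≤ _ := by gcongr
  calc Q (closeEvent T R v v' r) ≤ Q (⋃ l, F l) + Q {ω | ∀ i, ω (w i) ∉ G} :=
        (measure_mono hcover).trans (measure_union_le _ _)
    _ ≤ ∑' l, Q (F l) := by
        rw [hnull, add_zero]
        exact measure_iUnion_le _
    _ ≤ ∑' l, (2⁻¹ : ℝ≥0∞) ^ l * (c * ENNReal.ofReal ((2 * (2 * R)) ^ d *
          ((2 * r) ^ (t : ℝ) / φ))) := ENNReal.tsum_le_tsum hterm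
    _ = 2 * (c * ENNReal.ofReal ((2 * (2 * R)) ^ d * ((2 * r) ^ (t : ℝ) / φ))) := by
        rw [ENNReal.tsum_mul_right, ENNReal.tsum_geometric, ENNReal.one_sub_inv_two, inv_inv]
    _ = _ := by
        have e : (2 * (2 * R)) ^ d * ((2 * r) ^ (t : ℝ) / φ) =
            ((2 * (2 * R)) ^ d * 2 ^ (t : ℝ)) * r ^ (t : ℝ) * φ⁻¹ := by
          rw [Real.mul_rpow zero_le_two hr.le]
          ring
        rw [e, ENNReal.ofReal_mul (by positivity), ENNReal.ofReal_mul (by positivity),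
          ENNReal.ofReal_inv_of_pos hφ0]
        push_cast
        simp only [ENNReal.ofReal]
        ring

end Transversality

/-! ### Energy estimates -/

section Energy

variable {d : ℕ} {n : ℕ → ℕ} {T : LinFamily d n}

open Classical in
/-- The contribution of the words of length `k` to the energy kernel. -/
def energyTerm (T : LinFamily d n) (t : ℝ≥0) (k : ℕ) (q : InfWord n × InfWord n) : ℝ≥0∞ :=
  if InfWord.take q.1 k = InfWord.take q.2 k then
    (ENNReal.ofReal (svf t (linComp T k (InfWord.take q.1 k))))⁻¹ else 0

theorem measurable_energyTerm (t : ℝ≥0) (k : ℕ) : Measurable (energyTerm T t k) := by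
  classical
  have h : Measurable fun p : Word n k × Word n k =>
      if p.1 = p.2 then (ENNReal.ofReal (svf t (linComp T k p.1)))⁻¹ else 0 :=
    measurable_of_countable _
  have h2 := h.comp (((measurable_take (n := n) k).comp measurable_fst).prodMk
    ((measurable_take (n := n) k).comp measurable_snd))
  have e : energyTerm T t k = (fun p : Word n k × Word n k =>
      if p.1 = p.2 then (ENNReal.ofReal (svf t (linComp T k p.1)))⁻¹ else 0) ∘
        fun q : InfWord n × InfWord n => (InfWord.take q.1 k, InfWord.take q.2 k) := by
    funext q
    simp only [energyTerm, Function.comp]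
  rw [e]
  exact h2

/-- For fixed `v`, the words that share its prefix of length `k` form one cylinder. -/
theorem lintegral_energyTerm (μ : Measure (InfWord n)) [IsProbabilityMeasure μ] (t : ℝ≥0)
    (k : ℕ) :
    ∫⁻ q, energyTerm T t k q ∂(μ.prod μ) =
      ∫⁻ v, (ENNReal.ofReal (svf t (linComp T k (InfWord.take v k))))⁻¹ *
        μ (cylinder ⟨k, InfWord.take v k⟩) ∂μ := by
  rw [lintegral_prod _ (measurable_energyTerm t k).aemeasurable]
  refine lintegral_congr fun v => ?_
  rw [← lintegral_indicator_const (measurableSet_cylinder _)]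
  refine lintegral_congr fun v' => ?_
  by_cases h : InfWord.take v k = InfWord.take v' k
  · rw [Set.indicator_of_mem (mem_cylinder_iff.2 h.symm)]
    simp [energyTerm, h]
  · rw [Set.indicator_of_notMem fun h' => h (mem_cylinder_iff.1 h').symm]
    simp [energyTerm, h]

theorem lintegral_energyTerm_ne_top (hd : 0 < d) {α : ℝ} (hα : 0 < α)
    (hlow : ∀ k j x, α * ‖x‖ ≤ ‖T k j x‖) (μ : Measure (InfWord n)) [IsProbabilityMeasure μ]
    (t : ℝ≥0) (k : ℕ) : ∫⁻ q, energyTerm T t k q ∂(μ.prod μ) ≠ ∞ := by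
  rw [lintegral_energyTerm]
  set S := ∑ u : Word n k, (ENNReal.ofReal (svf t (linComp T k u)))⁻¹ with hS
  have hStop : S ≠ ∞ := ENNReal.sum_ne_top.2 fun u _ => ENNReal.inv_ne_top.2
    (ENNReal.ofReal_pos.2 (svf_pos (singVal_linComp_pos hα hlow k u) hd t)).ne'
  refine ne_top_of_le_ne_top hStop ?_
  calc _ ≤ ∫⁻ _v, S ∂μ := lintegral_mono fun v => by
        calc _ ≤ (ENNReal.ofReal (svf t (linComp T k (InfWord.take v k))))⁻¹ * 1 := by
              gcongr
              exact prob_le_one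
          _ = _ := mul_one _
          _ ≤ S := Finset.single_le_sum
              (f := fun u : Word n k => (ENNReal.ofReal (svf t (linComp T k u)))⁻¹)
              (fun _ _ => zero_le) (Finset.mem_univ _)
    _ = S := by simp

/-- The cylinder bound turns the integrand into at most `C φ^{t'}/φ^t`, and all singular values of
`T_u` are at most `β^k`. -/
theorem lintegral_energyTerm_le (hd : 0 < d) {α β : ℝ} (hα : 0 < α) (hβ : 0 < β)
    (hlow : ∀ k j x, α * ‖x‖ ≤ ‖T k j x‖) (hup : ∀ k j x, ‖T k j x‖ ≤ β * ‖x‖)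
    (μ : Measure (InfWord n)) [IsProbabilityMeasure μ] {t t' : ℝ≥0} (htt' : t ≤ t') (ht : t ≤ d)
    {C : ℝ≥0} {k : ℕ} (hμ : ∀ u : Word n k,
      μ (cylinder ⟨k, u⟩) ≤ C * ENNReal.ofReal (svf t' (linComp T k u))) :
    ∫⁻ q, energyTerm T t k q ∂(μ.prod μ) ≤
      C * ENNReal.ofReal (β ^ ((t' : ℝ) - t)) ^ k := by
  rw [lintegral_energyTerm]
  calc _ ≤ ∫⁻ _v, C * ENNReal.ofReal (β ^ ((t' : ℝ) - t)) ^ k ∂μ := lintegral_mono fun v => by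
        set A := linComp T k (InfWord.take v k) with hA
        have hpos := singVal_linComp_pos hα hlow k (InfWord.take v k)
        have hφ : 0 < svf t A := svf_pos hpos hd t
        have h1 : svf t' A ≤ svf t A * (β ^ ((t' : ℝ) - t)) ^ k := by
          have := svf_le_svf_mul hpos hd htt' ht (c := β ^ k) fun i hi =>
            singVal_le_of_forall_norm_le (norm_linComp_le hβ.le hup k _) hi
          refine this.trans_eq ?_
          rw [← Real.rpow_natCast, ← Real.rpow_mul hβ.le, ← Real.rpow_natCast,
            ← Real.rpow_mul hβ.le, mul_comm (k : ℝ)]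
        calc _ ≤ (ENNReal.ofReal (svf t A))⁻¹ * (C * ENNReal.ofReal (svf t' A)) := by
              gcongr
              exact hμ _
          _ ≤ (ENNReal.ofReal (svf t A))⁻¹ *
              (C * ENNReal.ofReal (svf t A * (β ^ ((t' : ℝ) - t)) ^ k)) := by gcongr
          _ = ((ENNReal.ofReal (svf t A))⁻¹ * ENNReal.ofReal (svf t A)) *
              (C * ENNReal.ofReal (β ^ ((t' : ℝ) - t)) ^ k) := by
              rw [ENNReal.ofReal_mul hφ.le, ENNReal.ofReal_pow (Real.rpow_nonneg hβ.le _)]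
              ring
          _ = _ := by
              rw [ENNReal.inv_mul_cancel (ENNReal.ofReal_pos.2 hφ).ne' ENNReal.ofReal_ne_top,
                one_mul]
    _ = _ := by simp

/-- The energy of a measure that is controlled by `φ^{t'}` on cylinders is finite with respect to
the kernel `φ^t`, `t < t'`. -/
theorem lintegral_tsum_energyTerm_ne_top (hd : 0 < d) {α β : ℝ} (hα : 0 < α) (hβ : 0 < β)
    (hβ1 : β < 1) (hlow : ∀ k j x, α * ‖x‖ ≤ ‖T k j x‖) (hup : ∀ k j x, ‖T k j x‖ ≤ β * ‖x‖)
    (μ : Measure (InfWord n)) [IsProbabilityMeasure μ] {t t' : ℝ≥0} (htt' : t < t') (ht : t ≤ d)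
    {C : ℝ≥0} {k₀ : ℕ} (hμ : ∀ k (u : Word n k), k₀ ≤ k →
      μ (cylinder ⟨k, u⟩) ≤ C * ENNReal.ofReal (svf t' (linComp T k u))) :
    ∫⁻ q, ∑' k, energyTerm T t k q ∂(μ.prod μ) ≠ ∞ := by
  rw [lintegral_tsum fun k => (measurable_energyTerm t k).aemeasurable]
  set b := ENNReal.ofReal (β ^ ((t' : ℝ) - t)) with hb
  have htt : 0 < (t' : ℝ) - t := sub_pos.2 (by exact_mod_cast htt')
  have hb1 : b < 1 := by
    rw [hb, ENNReal.ofReal_lt_one]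
    exact Real.rpow_lt_one hβ.le hβ1 htt
  have hgeo : ∑' k, (C * b ^ k : ℝ≥0∞) ≠ ∞ := by
    rw [ENNReal.tsum_mul_left, ENNReal.tsum_geometric]
    exact ENNReal.mul_ne_top ENNReal.coe_ne_top (ENNReal.inv_ne_top.2 (tsub_pos_of_lt hb1).ne')
  -- The cylinder bound is available only from `k₀` on; each earlier term is finite because there
  -- are finitely many words of that length.
  rw [← (ENNReal.summable).sum_add_tsum_nat_add' (k := k₀)]
  refine ENNReal.add_ne_top.2 ⟨ENNReal.sum_ne_top.2 fun k _ =>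
    lintegral_energyTerm_ne_top hd hα hlow μ t k, ?_⟩
  refine ne_top_of_le_ne_top hgeo ?_
  calc _ ≤ ∑' k, (C * b ^ (k + k₀) : ℝ≥0∞) := ENNReal.tsum_le_tsum fun k =>
        lintegral_energyTerm_le hd hα hβ hlow hup μ htt'.le ht fun u => hμ _ u (by omega)
    _ ≤ _ := ENNReal.tsum_comp_le_tsum_of_injective (add_left_injective k₀)
        (fun k => (C * b ^ k : ℝ≥0∞))

/-- Comparison with `φ^0 = 1`. This makes every term of the energy kernel at least `1` on the
diagonal, where the kernel is thus infinite. -/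
theorem svf_linComp_le_one (hd : 0 < d) {α : ℝ} (hα : 0 < α)
    (hlow : ∀ k j x, α * ‖x‖ ≤ ‖T k j x‖) (hone : ∀ k j x, ‖T k j x‖ ≤ 1 * ‖x‖) (t : ℝ≥0) (k : ℕ)
    (u : Word n k) : svf t (linComp T k u) ≤ 1 := by
  have hpos := singVal_linComp_pos hα hlow k u
  have h := svf_le_svf_mul hpos hd (zero_le (a := t)) zero_le (c := 1) fun i hi =>
    (singVal_le_of_forall_norm_le (norm_linComp_le zero_le_one hone k u) hi).trans_eq (one_pow k)
  refine h.trans_eq ?_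
  rw [Real.one_rpow, mul_one, svf_eq_prod hd zero_le]
  refine Finset.prod_eq_one fun i _ => ?_
  have : svExp ((0 : ℝ≥0) : ℝ) i = 0 := by
    simp [svExp]
  rw [this, Real.rpow_zero]

/-- The pairs of addresses of points at distance at most `r`, empty for translations that are not
bounded by `R`. -/
def closePairs (T : LinFamily d n) (R r : ℝ) (ω : FinWord n → Space d) :
    Set (InfWord n × InfWord n) :=
  {q | (∀ u, ‖ω u‖ ≤ R) ∧ dist (limitPoint T ω q.1) (limitPoint T ω q.2) ≤ r}

theorem measurableSet_closePairs_prod (R r : ℝ) :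
    MeasurableSet {z : (FinWord n → Space d) × (InfWord n × InfWord n) |
      z.2 ∈ closePairs T R r z.1} := by
  have g1 : Measurable fun z : (FinWord n → Space d) × (InfWord n × InfWord n) => (z.1, z.2.1) :=
    measurable_fst.prodMk (measurable_fst.comp measurable_snd)
  have g2 : Measurable fun z : (FinWord n → Space d) × (InfWord n × InfWord n) => (z.1, z.2.2) :=
    measurable_fst.prodMk (measurable_snd.comp measurable_snd)
  have h1 := (measurable_limitPoint T).comp g1
  have h2 := (measurable_limitPoint T).comp g2
  have h3 : MeasurableSet ((Prod.fst : (FinWord n → Space d) × (InfWord n × InfWord n) → _) ⁻¹'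
      {ω | ∀ u, ‖ω u‖ ≤ R}) := measurable_fst (measurableSet_bounded R)
  have h4 : MeasurableSet {z : (FinWord n → Space d) × (InfWord n × InfWord n) |
      dist (limitPoint T z.1 z.2.1) (limitPoint T z.1 z.2.2) ≤ r} :=
    measurableSet_le (h1.dist h2) measurable_const
  exact h3.inter h4

theorem measurable_measure_closePairs (μ : Measure (InfWord n)) [IsProbabilityMeasure μ]
    (R r : ℝ) : Measurable fun ω => (μ.prod μ) (closePairs T R r ω) :=
  measurable_measure_prodMk_left (measurableSet_closePairs_prod R r)

/-- The expected mass of the pairs of addresses of close points. -/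
theorem exists_lintegral_closePairs_le (hd : 0 < d) {α β : ℝ} (hα : 0 < α) (hβ : 0 < β)
    (hβ1 : β < 1) (hlow : ∀ k j x, α * ‖x‖ ≤ ‖T k j x‖) (hup : ∀ k j x, ‖T k j x‖ ≤ β * ‖x‖)
    (P : Measure (Space d)) [IsProbabilityMeasure P] (hP : P ≪ volume) {R : ℝ} (hR : 1 ≤ R)
    (μ : Measure (InfWord n)) [IsProbabilityMeasure μ] {t t' : ℝ≥0} (htt' : t < t') (ht : t ≤ d)
    {C : ℝ≥0} {k₀ : ℕ} (hμ : ∀ k (u : Word n k), k₀ ≤ k →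
      μ (cylinder ⟨k, u⟩) ≤ C * ENNReal.ofReal (svf t' (linComp T k u))) :
    ∃ C' : ℝ≥0, ∀ r : ℝ, 0 < r →
      ∫⁻ ω, (μ.prod μ) (closePairs T R r ω) ∂(Measure.infinitePi fun _ : FinWord n => P) ≤
        C' * ENNReal.ofReal (r ^ (t : ℝ)) := by
  classical
  obtain ⟨C₁, hC₁⟩ := exists_measure_closeEvent_le hd hα hβ.le hβ1 hlow hup P hP hR ht
  have hE := lintegral_tsum_energyTerm_ne_top hd hα hβ hβ1 hlow hup μ htt' ht hμ
  set I := ∫⁻ q, ∑' k, energyTerm T t k q ∂(μ.prod μ) with hI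
  set Q := Measure.infinitePi fun _ : FinWord n => P with hQ
  -- Adding `1` keeps the factor nonzero, so that its product with the infinite kernel on the
  -- diagonal is infinite.
  refine ⟨(C₁ + 1) * I.toNNReal, fun r hr => ?_⟩
  have hrt : 0 < ENNReal.ofReal (r ^ (t : ℝ)) := ENNReal.ofReal_pos.2 (Real.rpow_pos_of_pos hr _)
  -- The kernel sums over all common prefixes; off the diagonal the term of the longest one
  -- suffices, and on it the right side is infinite.
  have hpoint : ∀ q : InfWord n × InfWord n, Q (closeEvent T R q.1 q.2 r) ≤
      (C₁ + 1) * ENNReal.ofReal (r ^ (t : ℝ)) * ∑' k, energyTerm T t k q := by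
    rintro ⟨v, v'⟩
    by_cases hvv : ∃ k, v k ≠ v' k
    · set k := Nat.find hvv with hk
      have htake : InfWord.take v k = InfWord.take v' k := funext fun i => by
        exact not_not.1 (Nat.find_min hvv i.2)
      calc _ ≤ C₁ * ENNReal.ofReal (r ^ (t : ℝ)) *
          (ENNReal.ofReal (svf t (linComp T k (InfWord.take v k))))⁻¹ :=
            hC₁ v v' k (Nat.find_spec hvv) r hr
        _ = C₁ * ENNReal.ofReal (r ^ (t : ℝ)) * energyTerm T t k (v, v') := by
            rw [energyTerm, if_pos htake]
        _ ≤ _ := by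
            gcongr
            · exact le_self_add
            · exact ENNReal.le_tsum k
    · push Not at hvv
      obtain rfl : v = v' := funext hvv
      have htop : ∑' k, energyTerm T t k (v, v) = ∞ := by
        refine top_unique ?_
        calc (∞ : ℝ≥0∞) = ∑' _k : ℕ, 1 := (ENNReal.tsum_const_eq_top_of_ne_zero one_ne_zero).symm
          _ ≤ _ := ENNReal.tsum_le_tsum fun k => by
              rw [energyTerm, if_pos rfl, ENNReal.one_le_inv]
              refine ENNReal.ofReal_le_one.2 (svf_linComp_le_one hd hα hlow ?_ t k _)
              exact fun k j x => (hup k j x).trans (by gcongr)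
      rw [htop, ENNReal.mul_top (by positivity)]
      exact le_top
  have hZ := measurableSet_closePairs_prod (T := T) R r
  calc ∫⁻ ω, (μ.prod μ) (closePairs T R r ω) ∂Q
      = (Q.prod (μ.prod μ)) {z | z.2 ∈ closePairs T R r z.1} :=
        (Measure.prod_apply hZ).symm
    _ = ∫⁻ q, Q (closeEvent T R q.1 q.2 r) ∂(μ.prod μ) := Measure.prod_apply_symm hZ
    _ ≤ ∫⁻ q, (C₁ + 1) * ENNReal.ofReal (r ^ (t : ℝ)) * ∑' k, energyTerm T t k q ∂(μ.prod μ) :=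
        lintegral_mono hpoint
    _ = (C₁ + 1) * ENNReal.ofReal (r ^ (t : ℝ)) * I := by
        rw [lintegral_const_mul _ (Measurable.tsum fun k => measurable_energyTerm t k)]
    _ = _ := by
        push_cast
        rw [ENNReal.coe_toNNReal hE]
        ring

end Energy

/-! ### From close pairs to Hausdorff measure and volume -/

section Deterministic

/-- A radius in `(0, 1]` is within a factor `2` of a dyadic one above it, which costs `2 ^ s`. -/
theorem measure_le_of_forall_dist_le {Ω X : Type*} [MeasurableSpace Ω] {μ : Measure Ω}
    [MetricSpace X] {f : Ω → X} {s : ℝ} (hs : 0 < s) {M : ℝ≥0∞} (hM : M ≠ ∞)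
    {v : Ω} (hv : ∀ q : ℕ, ENNReal.ofReal ((2 ^ q) ^ s) *
      μ {v' | dist (f v) (f v') ≤ (2⁻¹ : ℝ) ^ q} ≤ M) {δ : ℝ} (hδ : 0 ≤ δ) (hδ1 : δ ≤ 1) :
    μ {v' | dist (f v) (f v') ≤ δ} ≤ M * ENNReal.ofReal (2 ^ s) * ENNReal.ofReal (δ ^ s) := by
  have hq : ∀ q : ℕ, μ {v' | dist (f v) (f v') ≤ (2⁻¹ : ℝ) ^ q} ≤
      M * ENNReal.ofReal ((2⁻¹ ^ q) ^ s) := by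
    intro q
    have hpos : (0 : ℝ) < (2 ^ q) ^ s := by positivity
    have h := hv q
    rw [mul_comm, ← ENNReal.le_div_iff_mul_le (Or.inl (ENNReal.ofReal_pos.2 hpos).ne')
      (Or.inl ENNReal.ofReal_ne_top)] at h
    refine h.trans_eq ?_
    rw [div_eq_mul_inv, ← ENNReal.ofReal_inv_of_pos hpos, ← Real.inv_rpow (by positivity), inv_pow]
  -- Radius `0` lies below all dyadic radii and is reached as `q → ∞`; it occurs later for sets of
  -- diameter `0`.
  rcases hδ.eq_or_lt with rfl | hδ0
  · have hle : ∀ q : ℕ, μ {v' | dist (f v) (f v') ≤ 0} ≤ M * ENNReal.ofReal ((2⁻¹ ^ q) ^ s) :=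
      fun q => (measure_mono fun v' (h : dist (f v) (f v') ≤ 0) =>
        show dist (f v) (f v') ≤ _ from h.trans (by positivity)).trans (hq q)
    have h1 : Tendsto (fun q : ℕ => ((2⁻¹ : ℝ) ^ q) ^ s) atTop (𝓝 0) := by
      have := (tendsto_pow_atTop_nhds_zero_of_lt_one (r := (2⁻¹ : ℝ)) (by norm_num)
        (by norm_num)).rpow_const (p := s) (Or.inr hs.le)
      rwa [Real.zero_rpow hs.ne'] at this
    have h2 : Tendsto (fun q : ℕ => M * ENNReal.ofReal ((2⁻¹ ^ q) ^ s)) atTop (𝓝 0) := by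
      have := ENNReal.Tendsto.const_mul (a := M) (ENNReal.tendsto_ofReal h1) (Or.inr hM)
      simpa using this
    exact (ge_of_tendsto' h2 hle).trans zero_le
  · obtain ⟨q, hq1, hq2⟩ := exists_nat_pow_near_of_lt_one hδ0 hδ1 (y := (2⁻¹ : ℝ)) (by norm_num)
      (by norm_num)
    calc _ ≤ μ {v' | dist (f v) (f v') ≤ (2⁻¹ : ℝ) ^ q} :=
          measure_mono fun v' (h : dist (f v) (f v') ≤ δ) =>
            show dist (f v) (f v') ≤ _ from h.trans hq2
      _ ≤ M * ENNReal.ofReal ((2⁻¹ ^ q) ^ s) := hq q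
      _ ≤ M * (ENNReal.ofReal (2 ^ s) * ENNReal.ofReal (δ ^ s)) := by
          gcongr
          rw [← ENNReal.ofReal_mul (by positivity), ← Real.mul_rpow zero_le_two hδ]
          refine ENNReal.ofReal_le_ofReal (Real.rpow_le_rpow (by positivity) ?_ hs.le)
          rw [pow_succ] at hq1
          linarith
      _ = _ := by ring

variable {Ω : Type*} [MeasurableSpace Ω] {μ : Measure Ω} [IsProbabilityMeasure μ]

theorem exists_nat_measure_le_pos {S : Ω → ℝ≥0∞} (hS : ∀ᵐ v ∂μ, S v < ∞) :
    ∃ M : ℕ, μ {v | S v < M} ≠ 0 := by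
  by_contra! h
  have hnull : μ (⋃ M : ℕ, {v | S v < M}) = 0 := measure_iUnion_null h
  have hsub : ∀ᵐ v ∂μ, v ∈ ⋃ M : ℕ, {v | S v < M} := by
    filter_upwards [hS] with v hv
    obtain ⟨M, hM⟩ := ENNReal.exists_nat_gt hv.ne
    exact Set.mem_iUnion.2 ⟨M, hM⟩
  have h1 : ∀ᵐ v ∂μ, v ∉ ⋃ M : ℕ, {v | S v < M} := measure_eq_zero_iff_ae_notMem.1 hnull
  have : ∀ᵐ _v ∂μ, False := by
    filter_upwards [hsub, h1] with v a b
    exact b a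
  exact IsProbabilityMeasure.ne_zero μ (by simpa using this)

variable {X : Type*} [MetricSpace X] [SecondCountableTopology X] [MeasurableSpace X]
  [BorelSpace X]

theorem measurableSet_dist_le_prod {f : Ω → X} (hf : Measurable f) (r : ℝ) :
    MeasurableSet {q : Ω × Ω | dist (f q.1) (f q.2) ≤ r} :=
  measurableSet_le ((hf.comp measurable_fst).dist (hf.comp measurable_snd)) measurable_const

theorem measurable_measure_dist_le {f : Ω → X} (hf : Measurable f) (r : ℝ) :
    Measurable fun v => μ {v' | dist (f v) (f v') ≤ r} :=
  measurable_measure_prodMk_left (measurableSet_dist_le_prod hf r)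

/-- A set that contains the image of a measure of finite energy has positive Hausdorff measure. -/
theorem hausdorffMeasure_ne_zero_of_tsum {f : Ω → X} (hf : Measurable f) {s : ℝ} (hs : 0 < s)
    (hsum : ∑' q : ℕ, ENNReal.ofReal ((2 ^ q) ^ s) *
      (μ.prod μ) {p | dist (f p.1) (f p.2) ≤ (2⁻¹ : ℝ) ^ q} ≠ ∞) {E : Set X}
    (hE : ∀ v, f v ∈ E) : Measure.hausdorffMeasure s E ≠ 0 := by
  set S : Ω → ℝ≥0∞ := fun v => ∑' q : ℕ, ENNReal.ofReal ((2 ^ q) ^ s) *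
    μ {v' | dist (f v) (f v') ≤ (2⁻¹ : ℝ) ^ q} with hSdef
  have hterm : ∀ q : ℕ, Measurable fun v => ENNReal.ofReal ((2 ^ q) ^ s) *
      μ {v' | dist (f v) (f v') ≤ (2⁻¹ : ℝ) ^ q} := fun q =>
    (measurable_measure_dist_le hf _).const_mul _
  have hSm : Measurable S := Measurable.tsum hterm
  have hSint : ∫⁻ v, S v ∂μ ≠ ∞ := by
    rw [hSdef, lintegral_tsum fun q => (hterm q).aemeasurable]
    convert hsum using 3 with q
    rw [lintegral_const_mul _ (measurable_measure_dist_le hf _),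
      Measure.prod_apply (measurableSet_dist_le_prod hf _)]
    rfl
  obtain ⟨M, hM⟩ := exists_nat_measure_le_pos (ae_lt_top hSm hSint)
  -- On `A` the ball estimate is uniform, and the mass distribution principle applies to the image
  -- of `μ` restricted to `A`.
  set A := {v | S v < M} with hA
  have hAm : MeasurableSet A := measurableSet_lt hSm measurable_const
  have hball : ∀ v ∈ A, ∀ δ : ℝ, 0 ≤ δ → δ ≤ 1 → μ {v' | dist (f v) (f v') ≤ δ} ≤
      (M : ℝ≥0∞) * ENNReal.ofReal (2 ^ s) * ENNReal.ofReal (δ ^ s) := fun v hv δ h0 h1 =>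
    measure_le_of_forall_dist_le hs (ENNReal.natCast_ne_top M)
      (fun q => (ENNReal.le_tsum q).trans (le_of_lt hv)) h0 h1
  set c : ℝ≥0∞ := M * ENNReal.ofReal (2 ^ s) with hc
  have hctop : c ≠ ∞ := ENNReal.mul_ne_top (ENNReal.natCast_ne_top M) ENNReal.ofReal_ne_top
  set ν := (μ.restrict A).map f with hν
  have hle : c⁻¹ • ν ≤ Measure.hausdorffMeasure s := by
    refine Measure.le_hausdorffMeasure s _ 1 one_pos fun B hB => ?_
    rw [Measure.smul_apply, smul_eq_mul]
    rw [mul_comm, ← div_eq_mul_inv]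
    refine ENNReal.div_le_of_le_mul' ?_
    -- The closure is measurable and has the same diameter.
    calc ν B ≤ ν (closure B) := measure_mono subset_closure
      _ = μ (f ⁻¹' closure B ∩ A) := by
          rw [hν, Measure.map_apply hf isClosed_closure.measurableSet,
            Measure.restrict_apply (hf isClosed_closure.measurableSet)]
      _ ≤ c * Metric.ediam B ^ s := by
          rcases (f ⁻¹' closure B ∩ A).eq_empty_or_nonempty with he | ⟨v, hvB, hvA⟩
          · rw [he, measure_empty]
            exact zero_le
          · have hBtop : Metric.ediam B ≠ ∞ := ne_top_of_le_ne_top ENNReal.one_ne_top hB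
            have hd1 : (Metric.ediam B).toReal ≤ 1 := ENNReal.toReal_le_of_le_ofReal zero_le_one
              (by simpa using hB)
            have h := hball v hvA (Metric.ediam B).toReal ENNReal.toReal_nonneg hd1
            rw [← ENNReal.ofReal_rpow_of_nonneg ENNReal.toReal_nonneg hs.le,
              ENNReal.ofReal_toReal hBtop] at h
            refine le_trans (measure_mono ?_) h
            rintro v' ⟨hv', -⟩
            show dist (f v) (f v') ≤ (Metric.ediam B).toReal
            rw [dist_edist]
            refine ENNReal.toReal_mono hBtop ?_
            rw [← Metric.ediam_closure]
            exact Metric.edist_le_ediam_of_mem hvB hv'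
  have hνE : μ A ≤ ν E := by
    calc μ A = (μ.restrict A) (f ⁻¹' E) := by
          rw [show f ⁻¹' E = Set.univ from Set.eq_univ_of_forall hE, Measure.restrict_apply_univ]
      _ ≤ _ := Measure.le_map_apply hf.aemeasurable _
  intro h0
  have h1 := hle E
  rw [h0, Measure.smul_apply, smul_eq_mul, nonpos_iff_eq_zero, mul_eq_zero,
    ENNReal.inv_eq_zero] at h1
  rcases h1 with h1 | h1
  · exact hctop h1
  · rw [h1] at hνE
    exact hM (nonpos_iff_eq_zero.1 hνE)

/-- A set that contains the image of a measure with finite lower densities has positive volume. -/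
theorem volume_ne_zero_of_liminf {d : ℕ} {f : Ω → Space d} (hf : Measurable f)
    (hlim : liminf (fun q : ℕ => ENNReal.ofReal ((2 ^ q) ^ d) *
      (μ.prod μ) {p | dist (f p.1) (f p.2) ≤ (2⁻¹ : ℝ) ^ q}) atTop ≠ ∞) {E : Set (Space d)}
    (hE : ∀ v, f v ∈ E) : volume E ≠ 0 := by
  set D : ℕ → Ω → ℝ≥0∞ := fun q v => ENNReal.ofReal ((2 ^ q) ^ d) *
    μ {v' | dist (f v) (f v') ≤ (2⁻¹ : ℝ) ^ q} with hD
  have hterm : ∀ q : ℕ, Measurable (D q) := fun q =>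
    (measurable_measure_dist_le hf _).const_mul _
  set S : Ω → ℝ≥0∞ := fun v => liminf (fun q => D q v) atTop with hSdef
  have hSm : Measurable S := Measurable.liminf hterm
  have hSint : ∫⁻ v, S v ∂μ ≠ ∞ := by
    refine ne_top_of_le_ne_top hlim ((lintegral_liminf_le hterm).trans_eq ?_)
    congr 1
    funext q
    simp only [hD]
    rw [lintegral_const_mul _ (measurable_measure_dist_le hf _),
      Measure.prod_apply (measurableSet_dist_le_prod hf _)]
    rfl
  obtain ⟨M, hM⟩ := exists_nat_measure_le_pos (ae_lt_top hSm hSint)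
  set A := {v | S v < M} with hA
  set ν := μ.map f with hν
  have hb0 : volume (Metric.ball (0 : Space d) 1) ≠ 0 :=
    (Metric.measure_ball_pos volume 0 one_pos).ne'
  have hbtop : volume (Metric.ball (0 : Space d) 1) ≠ ∞ := measure_ball_lt_top.ne
  -- With this constant, `M * (2⁻¹ ^ q) ^ d` is `c` times the volume of a ball of radius `2⁻¹ ^ q`.
  set c : ℝ≥0 := (M / volume (Metric.ball (0 : Space d) 1)).toNNReal with hc
  have hcoe : (c : ℝ≥0∞) = M / volume (Metric.ball (0 : Space d) 1) :=
    ENNReal.coe_toNNReal (ENNReal.div_ne_top (ENNReal.natCast_ne_top M) hb0)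
  have hνp : IsProbabilityMeasure ν := Measure.isProbabilityMeasure_map hf.aemeasurable
  -- At each point of `f '' A`, arbitrarily small closed balls satisfy `ν ≤ c • volume`;
  -- differentiation along the Besicovitch family carries the inequality over to the set itself.
  have hνS : ν (f '' A) ≤ (c • (volume : Measure (Space d))) (f '' A) := by
    refine (Besicovitch.vitaliFamily ν).measure_le_of_frequently_le _
      Measure.AbsolutelyContinuous.rfl _ ?_
    rintro _ ⟨v, hv, rfl⟩
    have hfreq : ∃ᶠ q : ℕ in atTop, D q v < M := frequently_lt_of_liminf_lt (by isBoundedDefault) hv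
    have htend : Tendsto (fun q : ℕ => (2⁻¹ : ℝ) ^ q) atTop (𝓝[>] 0) :=
      tendsto_nhdsWithin_iff.2 ⟨tendsto_pow_atTop_nhds_zero_of_lt_one (by norm_num) (by norm_num),
        Eventually.of_forall fun q => Set.mem_Ioi.2 (by positivity)⟩
    refine ((Besicovitch.tendsto_filterAt ν (f v)).comp htend).frequently (hfreq.mono ?_)
    intro q hq
    simp only [Function.comp]
    have e1 : ν (Metric.closedBall (f v) (2⁻¹ ^ q)) =
        μ {v' | dist (f v) (f v') ≤ (2⁻¹ : ℝ) ^ q} := by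
      rw [hν, Measure.map_apply hf measurableSet_closedBall]
      congr 1
      ext v'
      simp [dist_comm]
    have hpos : (0 : ℝ) < (2 ^ q) ^ d := by positivity
    have h2 : μ {v' | dist (f v) (f v') ≤ (2⁻¹ : ℝ) ^ q} ≤
        M * ENNReal.ofReal ((2⁻¹ ^ q) ^ d) := by
      have h := hq.le
      simp only [hD] at h
      rw [mul_comm, ← ENNReal.le_div_iff_mul_le (Or.inl (ENNReal.ofReal_pos.2 hpos).ne')
        (Or.inl ENNReal.ofReal_ne_top)] at h
      refine h.trans_eq ?_
      rw [div_eq_mul_inv, ← ENNReal.ofReal_inv_of_pos hpos, inv_pow, inv_pow]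
    rw [e1, Measure.smul_apply, Measure.addHaar_closedBall _ _ (by positivity), ENNReal.smul_def,
      hcoe, smul_eq_mul, finrank_euclideanSpace_fin]
    refine h2.trans_eq ?_
    rw [mul_comm (ENNReal.ofReal _) (volume _), ← mul_assoc, ENNReal.div_mul_cancel hb0 hbtop]
  intro h0
  have h1 : volume (f '' A) = 0 := measure_mono_null (Set.image_subset_iff.2 fun v _ => hE v) h0
  rw [Measure.smul_apply, h1, smul_zero] at hνS
  refine hM (nonpos_iff_eq_zero.1 (le_trans ?_ hνS))
  exact (measure_mono (Set.subset_preimage_image f A)).trans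
    (Measure.le_map_apply hf.aemeasurable _)

end Deterministic

/-! ### Dimension and volume of the Moran set -/

section MoranSets

variable {d : ℕ} {n : ℕ → ℕ} {T : LinFamily d n} {J : Set (Space d)} {ω : FinWord n → Space d}

theorem IsMoranStructure.basicSet_take_antitone (hM : IsMoranStructure T J ω) (v : InfWord n) :
    Antitone fun k => basicSet T J ω k (InfWord.take v k) :=
  antitone_nat_of_succ_le fun k => hM.nested k (InfWord.take v (k + 1))

/-- The images of one fixed point of `J` under the maps `Ψ_{v|m}` converge to the limit point; by
nesting, those with `m ≥ k` lie in the closed set `J_{v|k}`. -/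
theorem IsMoranStructure.limitPoint_mem (hM : IsMoranStructure T J ω) (hJ : J.Nonempty) {β : ℝ}
    (hβ : 0 ≤ β) (hβ1 : β < 1) (hup : ∀ k j x, ‖T k j x‖ ≤ β * ‖x‖) {R : ℝ}
    (hω : ∀ u, ‖ω u‖ ≤ R) (v : InfWord n) : limitPoint T ω v ∈ moranSet T J ω := by
  obtain ⟨x, hx⟩ := hJ
  have hlin : Tendsto (fun m => linComp T m (InfWord.take v m) x) atTop (𝓝 0) := by
    refine squeeze_zero_norm (fun m => norm_linComp_le hβ hup m _ x) ?_
    simpa using (tendsto_pow_atTop_nhds_zero_of_lt_one hβ hβ1).mul_const ‖x‖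
  have hlim : Tendsto (fun m => affComp T ω m (InfWord.take v m) x) atTop
      (𝓝 (limitPoint T ω v)) := by
    have := hlin.add (tendsto_limitPoint hβ hβ1 hup hω v)
    rw [zero_add] at this
    exact this.congr fun m => (affComp_eq_add ω m _ x).symm
  refine Set.mem_iInter₂.2 fun k _ => Set.mem_iUnion.2 ⟨InfWord.take v k, ?_⟩
  refine (hM.isClosed k _).mem_of_tendsto hlim ?_
  filter_upwards [eventually_ge_atTop k] with m hm
  exact hM.basicSet_take_antitone v hm (Set.mem_image_of_mem _ hx)

theorem InfWord.exists_take_eq (hn : ∀ k, 2 ≤ n k) {k : ℕ} (u : Word n k) :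
    ∃ v : InfWord n, InfWord.take v k = u := by
  classical
  refine ⟨fun i => if h : i < k then u ⟨i, h⟩ else ⟨0, by linarith [hn i]⟩, funext fun i => ?_⟩
  simp [InfWord.take]

/-- Every point of the Moran set has an address. -/
theorem IsMoranStructure.exists_address (hn : ∀ k, 2 ≤ n k) (hM : IsMoranStructure T J ω)
    {x : Space d} (hx : x ∈ moranSet T J ω) :
    ∃ v : InfWord n, ∀ k, x ∈ basicSet T J ω k (InfWord.take v k) := by
  -- A nested sequence of nonempty closed sets in the compact space of infinite words. The shift by
  -- one matches the Moran set, which starts at level `1`; level `0` follows by nesting.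
  set C : ℕ → Set (InfWord n) :=
    fun k => {v | x ∈ basicSet T J ω (k + 1) (InfWord.take v (k + 1))} with hC
  have hcont : ∀ k, Continuous fun v : InfWord n => InfWord.take v k := fun k =>
    continuous_pi fun _ => continuous_apply _
  have hclosed : ∀ k, IsClosed (C k) := fun k =>
    (isClosed_discrete {u : Word n (k + 1) | x ∈ basicSet T J ω (k + 1) u}).preimage
      (hcont (k + 1))
  have hne : ∀ k, (C k).Nonempty := fun k => by
    obtain ⟨u, hu⟩ := Set.mem_iUnion.1 (Set.mem_iInter₂.1 hx (k + 1) (by omega))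
    obtain ⟨v, rfl⟩ := InfWord.exists_take_eq hn u
    exact ⟨v, hu⟩
  obtain ⟨v, hv⟩ := IsCompact.nonempty_iInter_of_sequence_nonempty_isCompact_isClosed C
    (fun k v hv => hM.nested _ _ hv) hne (hclosed 0).isCompact hclosed
  refine ⟨v, fun k => ?_⟩
  have h : x ∈ basicSet T J ω (k + 1) (InfWord.take v (k + 1)) := Set.mem_iInter.1 hv k
  exact hM.nested k _ h

/-- A basic set is covered by sets whose sizes are controlled by the singular value function. -/
theorem exists_cover_basicSet (hd : 0 < d) {α : ℝ} (hα : 0 < α)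
    (hlow : ∀ k j x, α * ‖x‖ ≤ ‖T k j x‖) {s : ℝ≥0} (hs : s ≤ d) {ρ : ℝ} (hρ : 0 < ρ)
    (hJ : ∀ x ∈ J, ‖x‖ ≤ ρ) (u : FinWord n) :
    ∃ (N : ℕ) (F : Fin N → Set (Space d)), basicSet T J ω u.1 u.2 ⊆ ⋃ i, F i ∧
      (∀ i, Metric.ediam (F i) ≤
        ENNReal.ofReal (2 * ρ * d * singVal (linComp T u.1 u.2) (⌈s⌉₊ - 1))) ∧
      ∑ i, Metric.ediam (F i) ^ (s : ℝ) ≤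
        ENNReal.ofReal (3 ^ (⌈s⌉₊ - 1) * (2 * ρ * d) ^ (s : ℝ)) *
          ENNReal.ofReal (svf s (linComp T u.1 u.2)) := by
  set A := linComp T u.1 u.2 with hA
  set p := ⌈s⌉₊ - 1 with hp
  have hpos := singVal_linComp_pos hα hlow u.1 u.2
  have hpd : p < d := ceil_sub_one_lt hd hs
  have hσ : 0 < singVal A p := hpos p hpd
  have hd0 : (0 : ℝ) < d := by exact_mod_cast hd
  obtain ⟨N, F, hcov, hN, hF⟩ := exists_cover_norm_le hpos hpd hρ hJ
  have hdiam : ∀ i, Metric.ediam (affComp T ω u.1 u.2 '' F i) ≤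
      ENNReal.ofReal (2 * ρ * d * singVal A p) := by
    intro i
    refine Metric.ediam_le ?_
    rintro _ ⟨x, hx, rfl⟩ _ ⟨y, hy, rfl⟩
    rw [edist_dist, dist_eq_norm, affComp_eq_add, affComp_eq_add ω u.1 u.2 y,
      add_sub_add_right_eq_sub, ← map_sub]
    exact ENNReal.ofReal_le_ofReal (hF i x hx y hy)
  refine ⟨N, fun i => affComp T ω u.1 u.2 '' F i, ?_, hdiam, ?_⟩
  · rw [← Set.image_iUnion]
    exact Set.image_mono hcov
  calc ∑ i : Fin N, Metric.ediam (affComp T ω u.1 u.2 '' F i) ^ (s : ℝ)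
      ≤ ∑ _i : Fin N, ENNReal.ofReal (2 * ρ * d * singVal A p) ^ (s : ℝ) :=
        Finset.sum_le_sum fun i _ => ENNReal.rpow_le_rpow (hdiam i) s.coe_nonneg
    _ = ENNReal.ofReal (N * (2 * ρ * d * singVal A p) ^ (s : ℝ)) := by
        rw [ENNReal.ofReal_mul (Nat.cast_nonneg N), ENNReal.ofReal_natCast,
          ENNReal.ofReal_rpow_of_nonneg (by positivity) s.coe_nonneg]
        simp
    _ ≤ _ := by
        rw [← ENNReal.ofReal_mul (by positivity)]
        refine ENNReal.ofReal_le_ofReal ?_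
        -- The number of pieces contributes `singVal A p ^ (-p)`, which combines with the power `s`
        -- into the last factor of `φ^s`.
        calc (N : ℝ) * (2 * ρ * d * singVal A p) ^ (s : ℝ)
            ≤ (3 ^ p * ∏ i ∈ Finset.range p, singVal A i / singVal A p) *
              (2 * ρ * d * singVal A p) ^ (s : ℝ) := by gcongr
          _ = _ := by
              rw [svf, if_pos hs, ← hp, Real.mul_rpow (by positivity) hσ.le,
                Finset.prod_div_distrib, Real.rpow_sub hσ, Real.rpow_natCast]
              simp only [Finset.prod_const, Finset.card_range]
              field_simp

/-- The upper bound for the Hausdorff dimension. -/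
theorem IsMoranStructure.dimH_le (hd : 0 < d) (hn : ∀ k, 2 ≤ n k) {α β : ℝ} (hα : 0 < α)
    (hβ : 0 ≤ β) (hβ1 : β < 1) (hlow : ∀ k j x, α * ‖x‖ ≤ ‖T k j x‖)
    (hup : ∀ k j x, ‖T k j x‖ ≤ β * ‖x‖) (hJ : Bornology.IsBounded J)
    (hM : IsMoranStructure T J ω) {s : ℝ≥0} (hs : s ≤ d)
    (hnet : netMeasure T s Set.univ = 0) : dimH (moranSet T J ω) ≤ s := by
  obtain ⟨ρ, hρ, hJρ⟩ := hJ.exists_pos_norm_le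
  have hpd := ceil_sub_one_lt hd hs
  -- Finite Hausdorff measure is enough for the dimension bound, so covers with sum below `1`
  -- suffice.
  have hA : ∀ k, ∃ A : Set (FinWord n), (∀ u ∈ A, k ≤ u.1) ∧
      Set.univ ⊆ ⋃ u ∈ A, cylinder u ∧
        ∑' u : A, ENNReal.ofReal (svf s (linComp T u.1.1 u.1.2)) < 1 := by
    intro k
    have h0 : netPremeasure T s k Set.univ = 0 :=
      nonpos_iff_eq_zero.1 (hnet ▸ le_iSup (fun k => netPremeasure T s k Set.univ) k)
    have hlt : netPremeasure T s k Set.univ < 1 := h0 ▸ one_pos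
    unfold netPremeasure at hlt
    simp only [iInf_lt_iff] at hlt
    obtain ⟨A, h1, h2, h3⟩ := hlt
    exact ⟨A, h1, h2, h3⟩
  choose A hAk hAcov hAsum using hA
  choose N F hFcov hFdiam hFsum using
    fun u => exists_cover_basicSet (ω := ω) hd hα hlow hs hρ hJρ u
  set c : ℝ≥0∞ := ENNReal.ofReal (3 ^ (⌈s⌉₊ - 1) * (2 * ρ * d) ^ (s : ℝ)) with hc
  have hbound := Measure.hausdorffMeasure_le_liminf_tsum (s : ℝ) (moranSet T J ω) (l := atTop)
    (ι := fun k : ℕ => Σ u : A k, Fin (N u.1)) (fun k => ENNReal.ofReal (2 * ρ * d * β ^ k))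
    (by
      have h := (tendsto_pow_atTop_nhds_zero_of_lt_one hβ hβ1).const_mul (2 * ρ * d)
      rw [mul_zero] at h
      simpa using ENNReal.tendsto_ofReal h)
    (fun k i => F i.1.1 i.2)
    (Eventually.of_forall fun k i => by
      refine (hFdiam _ _).trans (ENNReal.ofReal_le_ofReal ?_)
      gcongr
      refine (singVal_le_of_forall_norm_le (norm_linComp_le hβ hup _ _) hpd).trans ?_
      exact pow_le_pow_of_le_one hβ hβ1.le (hAk k _ i.1.2))
    (Eventually.of_forall fun k x hx => by
      obtain ⟨v, hv⟩ := hM.exists_address hn hx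
      obtain ⟨u, huA, huv⟩ := Set.mem_iUnion₂.1 (hAcov k (Set.mem_univ v))
      have hxu : x ∈ basicSet T J ω u.1 u.2 := by
        rw [← mem_cylinder_iff.1 huv]
        exact hv u.1
      obtain ⟨i, hi⟩ := Set.mem_iUnion.1 (hFcov u hxu)
      exact Set.mem_iUnion.2 ⟨⟨⟨u, huA⟩, i⟩, hi⟩)
  refine dimH_le_of_hausdorffMeasure_ne_top (ne_top_of_le_ne_top ENNReal.ofReal_ne_top
    (b := c) (hbound.trans ?_))
  refine (liminf_le_liminf (v := fun _ => c) (Eventually.of_forall fun k => ?_)).trans_eq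
    (liminf_const c)
  calc ∑' i : (Σ u : A k, Fin (N u.1)), Metric.ediam (F i.1.1 i.2) ^ (s : ℝ)
      = ∑' u : A k, ∑ i, Metric.ediam (F u.1 i) ^ (s : ℝ) := by
        rw [ENNReal.tsum_sigma']
        simp only [tsum_fintype]
    _ ≤ ∑' u : A k, c * ENNReal.ofReal (svf s (linComp T u.1.1 u.1.2)) :=
        ENNReal.tsum_le_tsum fun u => hFsum u.1
    _ ≤ c * 1 := by
        rw [ENNReal.tsum_mul_left]
        gcongr
        exact (hAsum k).le
    _ = c := mul_one c

theorem netMeasure_ne_zero_of_lt_criticalValue {s : ℝ≥0} (hs : (s : ℝ≥0∞) < criticalValue T) :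
    netMeasure T s Set.univ ≠ 0 := fun h =>
  not_le.2 hs (iInf₂_le (f := fun (s : ℝ≥0) (_ : netMeasure T s Set.univ = 0) => (s : ℝ≥0∞)) s h)

theorem closePairs_of_bounded {R : ℝ} (hω : ∀ u, ‖ω u‖ ≤ R) (r : ℝ) :
    closePairs T R r ω = {q | dist (limitPoint T ω q.1) (limitPoint T ω q.2) ≤ r} :=
  Set.ext fun _ => ⟨fun h => h.2, fun h => ⟨hω, h⟩⟩

theorem measurable_limitPoint_right (ω : FinWord n → Space d) :
    Measurable fun v : InfWord n => limitPoint T ω v := by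
  have hω : Measurable fun v : InfWord n => (ω, v) := measurable_prodMk_left
  simpa only [Function.comp_def] using (measurable_limitPoint T).comp hω

/-- The almost sure lower bound for the Hausdorff dimension. -/
theorem ae_le_dimH (hd : 0 < d) (hn : ∀ k, 2 ≤ n k) {α β : ℝ} (hα : 0 < α) (hβ : 0 < β)
    (hβ1 : β < 1) (hlow : ∀ k j x, α * ‖x‖ ≤ ‖T k j x‖) (hup : ∀ k j x, ‖T k j x‖ ≤ β * ‖x‖)
    (P : Measure (Space d)) [IsProbabilityMeasure P] (hP : P ≪ volume) {R : ℝ} (hR : 1 ≤ R)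
    (hJ : J.Nonempty) {s : ℝ≥0} (hs : 0 < s) (hsd : s < d)
    (hsc : (s : ℝ≥0∞) < criticalValue T) :
    ∀ᵐ ω ∂(Measure.infinitePi fun _ : FinWord n => P), (∀ u, ‖ω u‖ ≤ R) →
      IsMoranStructure T J ω → (s : ℝ≥0∞) ≤ dimH (moranSet T J ω) := by
  -- Exponents `s < t < t'` with `t' < s_A` and `t < d`: the gap `t < t'` makes the energy finite,
  -- the gap `s < t` makes the sum over dyadic radii converge.
  obtain ⟨t, hst, htm⟩ := ENNReal.lt_iff_exists_nnreal_btwn.1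
    (lt_min hsc (by exact_mod_cast hsd : (s : ℝ≥0∞) < d))
  obtain ⟨t', htt', ht'c⟩ := ENNReal.lt_iff_exists_nnreal_btwn.1 (lt_min_iff.1 htm).1
  have hst : s < t := by exact_mod_cast hst
  have htt' : t < t' := by exact_mod_cast htt'
  have htd : t ≤ d := by exact_mod_cast (lt_min_iff.1 htm).2.le
  obtain ⟨μ, hμp, C, k₀, hμ⟩ := exists_frostman_measure T t' hn
    (netMeasure_ne_zero_of_lt_criticalValue ht'c)
  obtain ⟨C', hC'⟩ := exists_lintegral_closePairs_le hd hα hβ hβ1 hlow hup P hP hR μ htt' htd hμ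
  set Q := Measure.infinitePi fun _ : FinWord n => P with hQ
  have hterm : ∀ q : ℕ, Measurable fun ω => ENNReal.ofReal (((2 : ℝ) ^ q) ^ (s : ℝ)) *
      (μ.prod μ) (closePairs T R ((2⁻¹ : ℝ) ^ q) ω) := fun q =>
    (measurable_measure_closePairs μ R _).const_mul _
  have hts : 0 < (t : ℝ) - s := sub_pos.2 (by exact_mod_cast hst)
  set b := ENNReal.ofReal ((2⁻¹ : ℝ) ^ ((t : ℝ) - s)) with hb
  have hb1 : b < 1 := by
    rw [hb, ENNReal.ofReal_lt_one]
    exact Real.rpow_lt_one (by norm_num) (by norm_num) hts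
  have hint : ∫⁻ ω, ∑' q : ℕ, ENNReal.ofReal (((2 : ℝ) ^ q) ^ (s : ℝ)) *
      (μ.prod μ) (closePairs T R ((2⁻¹ : ℝ) ^ q) ω) ∂Q ≠ ∞ := by
    rw [lintegral_tsum fun q => (hterm q).aemeasurable]
    have hgeo : ∑' q : ℕ, (C' * b ^ q : ℝ≥0∞) ≠ ∞ := by
      rw [ENNReal.tsum_mul_left, ENNReal.tsum_geometric]
      exact ENNReal.mul_ne_top ENNReal.coe_ne_top (ENNReal.inv_ne_top.2 (tsub_pos_of_lt hb1).ne')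
    refine ne_top_of_le_ne_top hgeo (ENNReal.tsum_le_tsum fun q => ?_)
    rw [lintegral_const_mul _ (measurable_measure_closePairs μ R _)]
    calc _ ≤ ENNReal.ofReal (((2 : ℝ) ^ q) ^ (s : ℝ)) *
          (C' * ENNReal.ofReal (((2⁻¹ : ℝ) ^ q) ^ (t : ℝ))) := by
          gcongr
          exact hC' _ (by positivity)
      _ = C' * ENNReal.ofReal (((2 : ℝ) ^ q) ^ (s : ℝ) * ((2⁻¹ : ℝ) ^ q) ^ (t : ℝ)) := by
          rw [ENNReal.ofReal_mul (by positivity)]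
          ring
      _ = _ := by
          rw [hb, ← ENNReal.ofReal_pow (by positivity)]
          congr 2
          rw [← Real.rpow_natCast, ← Real.rpow_natCast, ← Real.rpow_natCast,
            Real.inv_rpow zero_le_two, Real.inv_rpow zero_le_two, Real.inv_rpow (by positivity),
            Real.inv_rpow (by positivity), ← Real.rpow_neg (by positivity),
            ← Real.rpow_neg (by positivity), ← Real.rpow_mul zero_le_two,
            ← Real.rpow_mul zero_le_two, ← Real.rpow_mul zero_le_two, ← Real.rpow_add two_pos]
          ring_nf
  filter_upwards [ae_lt_top (Measurable.tsum hterm) hint] with ω hfin hω hM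
  refine le_dimH_of_hausdorffMeasure_ne_zero ?_
  refine hausdorffMeasure_ne_zero_of_tsum (μ := μ) (measurable_limitPoint_right (T := T) ω)
    (NNReal.coe_pos.2 hs) ?_ (fun v => hM.limitPoint_mem hJ hβ.le hβ1 hup hω v)
  simp only [closePairs_of_bounded hω] at hfin
  exact hfin.ne

/-- The almost sure positivity of the volume. -/
theorem ae_volume_ne_zero (hd : 0 < d) (hn : ∀ k, 2 ≤ n k) {α β : ℝ} (hα : 0 < α) (hβ : 0 < β)
    (hβ1 : β < 1) (hlow : ∀ k j x, α * ‖x‖ ≤ ‖T k j x‖) (hup : ∀ k j x, ‖T k j x‖ ≤ β * ‖x‖)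
    (P : Measure (Space d)) [IsProbabilityMeasure P] (hP : P ≪ volume) {R : ℝ} (hR : 1 ≤ R)
    (hJ : J.Nonempty) (hdc : (d : ℝ≥0∞) < criticalValue T) :
    ∀ᵐ ω ∂(Measure.infinitePi fun _ : FinWord n => P), (∀ u, ‖ω u‖ ≤ R) →
      IsMoranStructure T J ω → volume (moranSet T J ω) ≠ 0 := by
  obtain ⟨t', htt', ht'c⟩ := ENNReal.lt_iff_exists_nnreal_btwn.1 hdc
  have htt' : (d : ℝ≥0) < t' := by exact_mod_cast htt'
  obtain ⟨μ, hμp, C, k₀, hμ⟩ := exists_frostman_measure T t' hn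
    (netMeasure_ne_zero_of_lt_criticalValue ht'c)
  obtain ⟨C', hC'⟩ := exists_lintegral_closePairs_le hd hα hβ hβ1 hlow hup P hP hR μ htt' le_rfl hμ
  set Q := Measure.infinitePi fun _ : FinWord n => P with hQ
  have hterm : ∀ q : ℕ, Measurable fun ω => ENNReal.ofReal (((2 : ℝ) ^ q) ^ d) *
      (μ.prod μ) (closePairs T R ((2⁻¹ : ℝ) ^ q) ω) := fun q =>
    (measurable_measure_closePairs μ R _).const_mul _
  -- At `t = d` the normalized expectations are bounded but need not be summable in `q`; Fatou's
  -- lemma controls their lower limit.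
  have hint : ∫⁻ ω, liminf (fun q : ℕ => ENNReal.ofReal (((2 : ℝ) ^ q) ^ d) *
      (μ.prod μ) (closePairs T R ((2⁻¹ : ℝ) ^ q) ω)) atTop ∂Q ≠ ∞ := by
    refine ne_top_of_le_ne_top (ENNReal.coe_ne_top (r := C')) ((lintegral_liminf_le hterm).trans ?_)
    refine (liminf_le_liminf (v := fun _ => (C' : ℝ≥0∞))
      (Eventually.of_forall fun q => ?_)).trans_eq (liminf_const _)
    rw [lintegral_const_mul _ (measurable_measure_closePairs μ R _)]
    calc _ ≤ ENNReal.ofReal (((2 : ℝ) ^ q) ^ d) *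
          (C' * ENNReal.ofReal (((2⁻¹ : ℝ) ^ q) ^ ((d : ℝ≥0) : ℝ))) := by
          gcongr
          exact hC' _ (by positivity)
      _ = C' * ENNReal.ofReal (((2 : ℝ) ^ q) ^ d * ((2⁻¹ : ℝ) ^ q) ^ d) := by
          rw [ENNReal.ofReal_mul (by positivity), NNReal.coe_natCast, Real.rpow_natCast]
          ring
      _ = _ := by
          rw [← mul_pow, ← mul_pow]
          norm_num
  filter_upwards [ae_lt_top (Measurable.liminf hterm) hint] with ω hfin hω hM
  refine volume_ne_zero_of_liminf (μ := μ) (measurable_limitPoint_right (T := T) ω) ?_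
    (fun v => hM.limitPoint_mem hJ hβ.le hβ1 hup hω v)
  simp only [closePairs_of_bounded hω] at hfin
  exact hfin.ne

end MoranSets

/-! ### Uniform bounds from `α_-`, `α_+` and the law of the translations -/

section Family

variable {d : ℕ} {n : ℕ → ℕ} {T : LinFamily d n}

theorem alphaMinus_mul_norm_le (k : ℕ) (j : Fin (n k)) (x : Space d) :
    alphaMinus T * ‖x‖ ≤ ‖T k j x‖ := by
  refine le_trans ?_ (singVal_last_le_norm (T k j) x)
  gcongr
  exact ciInf_le (f := fun p : Σ k : ℕ, Fin (n k) => singVal (T p.1 p.2) (d - 1))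
    ⟨0, by rintro _ ⟨p, rfl⟩; exact singVal_nonneg _ _⟩ ⟨k, j⟩

theorem singVal_zero_le_alphaPlus (hd : 0 < d) (hT : ∀ (k : ℕ) (j : Fin (n k)), ‖T k j‖ < 1)
    (k : ℕ) (j : Fin (n k)) : singVal (T k j) 0 ≤ alphaPlus T := by
  refine le_ciSup (f := fun p : Σ k : ℕ, Fin (n k) => singVal (T p.1 p.2) 0) ⟨1, ?_⟩ ⟨k, j⟩
  rintro _ ⟨p, rfl⟩
  exact (singVal_le_of_forall_norm_le (fun x => (T p.1 p.2).le_opNorm x) hd).trans (hT _ _).le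

theorem norm_le_alphaPlus_mul (hd : 0 < d) (hT : ∀ (k : ℕ) (j : Fin (n k)), ‖T k j‖ < 1)
    (k : ℕ) (j : Fin (n k)) (x : Space d) : ‖T k j x‖ ≤ alphaPlus T * ‖x‖ := by
  refine (norm_le_singVal_zero (T k j) x).trans ?_
  gcongr
  exact singVal_zero_le_alphaPlus hd hT k j

theorem alphaPlus_pos (hd : 0 < d) (hn : ∀ k, 2 ≤ n k)
    (hT : ∀ (k : ℕ) (j : Fin (n k)), ‖T k j‖ < 1) (hminus : 0 < alphaMinus T) :
    0 < alphaPlus T := by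
  have j : Fin (n 0) := ⟨0, by linarith [hn 0]⟩
  refine lt_of_lt_of_le hminus ((le_singVal_of_forall_le_norm (A := T 0 j)
    (alphaMinus_mul_norm_le 0 j) hd).trans (singVal_zero_le_alphaPlus hd hT 0 j))

theorem ae_forall_norm_le {P : Measure (Space d)} [IsProbabilityMeasure P] {R : ℝ}
    (hP : ∀ᵐ x ∂P, ‖x‖ ≤ R) :
    ∀ᵐ ω ∂(Measure.infinitePi fun _ : FinWord n => P), ∀ u, ‖ω u‖ ≤ R :=
  ae_all_iff.2 fun u => (measurePreserving_eval_infinitePi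
    (fun _ : FinWord n => P) u).quasiMeasurePreserving.ae hP

end Family

end MoranSet

end

/-! ### The main theorem -/

theorem theorem2p5 (d : ℕ) (hd : 0 < d) (n : ℕ → ℕ) (hn : ∀ k, 2 ≤ n k)
    (T : MoranSet.LinFamily d n) (hT : ∀ (k : ℕ) (j : Fin (n k)), ‖T k j‖ < 1)
    (hminus : 0 < MoranSet.alphaMinus T) (hplus : MoranSet.alphaPlus T < 1)
    (J : Set (MoranSet.Space d)) (hJ : IsCompact J) (hJint : (interior J).Nonempty)
    (D : Set (MoranSet.Space d)) (hD : Bornology.IsBounded D)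
    (P : Measure (MoranSet.Space d)) [IsProbabilityMeasure P]
    (hPD : ∀ᵐ x ∂P, x ∈ D) (hPac : P ≪ volume)
    (hMoran : ∀ᵐ ω ∂(Measure.infinitePi (fun _ : MoranSet.FinWord n => P)),
      MoranSet.IsMoranStructure T J ω) :
    ∀ᵐ ω ∂(Measure.infinitePi (fun _ : MoranSet.FinWord n => P)),
      (MoranSet.criticalValue T ≤ (d : ℝ≥0∞) →
        dimH (MoranSet.moranSet T J ω) = MoranSet.criticalValue T) ∧
      ((d : ℝ≥0∞) < MoranSet.criticalValue T →
        0 < volume (MoranSet.moranSet T J ω)) := by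
  open MoranSet in
  have hlow := alphaMinus_mul_norm_le (T := T)
  have hup := norm_le_alphaPlus_mul hd hT
  have hβ := alphaPlus_pos hd hn hT hminus
  have hJne : J.Nonempty := hJint.mono interior_subset
  obtain ⟨R₀, hR₀⟩ := hD.exists_norm_le
  set R := max R₀ 1 with hRdef
  have hR : 1 ≤ R := le_max_right _ _
  have hbdd := ae_forall_norm_le (n := n) (P := P) (R := R)
    (hPD.mono fun x hx => (hR₀ x hx).trans (le_max_left _ _))
  rcases le_or_gt (criticalValue T) (d : ℝ≥0∞) with hle | hgt
  -- Rational exponents are countable, so a single null set serves them all.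
  · have hlower : ∀ᵐ ω ∂(Measure.infinitePi (fun _ : FinWord n => P)), ∀ q : ℚ,
        0 < Real.toNNReal q → (Real.toNNReal q : ℝ≥0∞) < criticalValue T →
          (∀ u, ‖ω u‖ ≤ R) → IsMoranStructure T J ω →
            (Real.toNNReal q : ℝ≥0∞) ≤ dimH (moranSet T J ω) := by
      refine ae_all_iff.2 fun q => ?_
      by_cases hq : 0 < Real.toNNReal q ∧ (Real.toNNReal q : ℝ≥0∞) < criticalValue T
      · filter_upwards [ae_le_dimH (J := J) hd hn hminus hβ hplus hlow hup P hPac hR hJne hq.1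
          (by exact_mod_cast hq.2.trans_le hle) hq.2] with ω h _ _ h1 h2
        exact h h1 h2
      · exact Eventually.of_forall fun ω h1 h2 => absurd ⟨h1, h2⟩ hq
    filter_upwards [hlower, hbdd, hMoran] with ω h1 h2 h3
    refine ⟨fun _ => le_antisymm ?_ ?_, fun h => absurd h (not_lt.2 hle)⟩
    -- If `s_A = d`, the net measure need not vanish for any `s ≤ d`; the dimension of the whole
    -- space gives the bound instead.
    · rcases hle.eq_or_lt with heq | hlt
      · rw [heq]
        calc dimH (moranSet T J ω) ≤ dimH (Set.univ : Set (Space d)) :=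
              dimH_mono (Set.subset_univ _)
          _ = d := by rw [Real.dimH_univ_eq_finrank]; simp
      · refine le_of_forall_gt fun a ha => ?_
        have ha' : criticalValue T < min a d := lt_min ha hlt
        simp only [criticalValue, iInf_lt_iff] at ha'
        obtain ⟨s, hs, hsa⟩ := ha'
        refine lt_of_le_of_lt (h3.dimH_le hd hn hminus hβ.le hplus hlow hup hJ.isBounded ?_ hs)
          (hsa.trans_le (min_le_left _ _))
        exact_mod_cast (hsa.trans_le (min_le_right _ _)).le
    · refine le_of_forall_lt fun a ha => ?_
      obtain ⟨q, -, hq1, hq2⟩ := ENNReal.lt_iff_exists_rat_btwn.1 ha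
      refine lt_of_lt_of_le hq1 (h1 q ?_ hq2 h2 h3)
      exact_mod_cast lt_of_le_of_lt zero_le hq1
  · filter_upwards [ae_volume_ne_zero (J := J) hd hn hminus hβ hplus hlow hup P hPac hR hJne hgt,
      hbdd, hMoran] with ω h1 h2 h3
    exact ⟨fun h => absurd h (not_le.2 hgt), fun _ => pos_iff_ne_zero.2 (h1 h2 h3)⟩
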